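/- Let $M$ be a smooth (finite-dimensional, Hausdorff, second countable) manifold and let $H\subset TM$ be a contact structure on $M$, i.e. a smooth hyperplane distribution such that, with $L=TM/H$ the (possibly non-trivial) normal line bundle, the curvature $H\times_M H\to L$, $(X,Y)\mapsto [X,Y]\bmod H$, is non-degenerate at every point. Let $\theta:TM\to L$ be the projection. *Jacobi bracket.* A vector field $X$ is a contact vector field if $[X,\Gamma(H)]\subset\Gamma(H)$. For $\lambda\in\Gamma(L)$ let $X_\lambda$ be the unique contact vector field with $\theta(X_\lambda)=\lambda$, and put $\{\lambda,\mu\}=\theta([X_\lambda,X_\mu])$. *Atiyah forms.* A derivation of $L$ is an $\mathbb R$-linear map $D:\Gamma(L)\to\Gamma(L)$ with $D(f\lambda)=f\,D\lambda+\sigma(D)(f)\lambda$ for a vector field $\sigma(D)$, its symbol. Derivations are the sections of a vector bundle $\mathsf DL\to M$, and $\Gamma(\mathsf J^1L)=\Omega^1_{\mathsf D}=\Gamma(\mathrm{Hom}(\mathsf DL,L))$, the first jet prolongation $j^1\lambda$ being $D\mapsto D\lambda$. Put $\Omega^2_{\mathsf D}=\Gamma(\mathrm{Hom}(\wedge^2\mathsf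 DL,L))$. The Jacobi tensor is the unique vector bundle map $J:\wedge^2\mathsf J^1L\to L$ with $\langle J,j^1\lambda\wedge j^1\mu\rangle=\{\lambda,\mu\}$ for all $\lambda,\mu\in\Gamma(L)$. Let $\Theta=\theta\circ\sigma\in\Omega^1_{\mathsf D}$ and $\omega=d_{\mathsf D}\Theta\in\Omega^2_{\mathsf D}$, i.e. $\omega(D,D')=D(\Theta(D'))-D'(\Theta(D))-\Theta([D,D'])$. *Lifts.* Let $\widetilde L=L^*\smallsetminus 0$. A section $\lambda\in\Gamma(L)$ lifts to the function $\widetilde\lambda(\varepsilon)=\langle\varepsilon,\lambda\rangle$ on $\widetilde L$. A derivation $D$ lifts to the unique vector field $\widetilde D$ on $\widetilde L$ with $\widetilde D(\widetilde\lambda)=\widetilde{D\lambda}$ for all $\lambda$. Forms $\psi\in\Omega^1_{\mathsf D}$ and $\eta\in\Omega^2_{\mathsf D}$ lift to the unique differential forms $\widetilde\psi,\widetilde\eta$ on $\widetilde L$ with $\widetilde\psi(\widetilde D)=\widetilde{\psi(D)}$ and $\widetilde\eta(\widetilde D,\widetilde D')=\widetilde{\eta(D,D')}$ for all derivations $D,D'$.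 The symplectization of $(M,H)$ is $(\widetilde L,\widetilde\omega)$. *Poisson structure.* For a function $f$ on $\widetilde L$ let $X_f$ be the vector field with $\widetilde\omega(X_f,-)=df$, and put $\{f,g\}_{\widetilde\omega}=\widetilde\omega(X_f,X_g)$. Likewise, the Poisson tensor $\widetilde J=\widetilde\omega^{-1}\in\Gamma(\wedge^2T\widetilde L)$ is $\langle\widetilde J,\alpha\wedge\beta\rangle=\widetilde\omega(\alpha^\sharp,\beta^\sharp)$, where $\widetilde\omega(\alpha^\sharp,-)=\alpha$. Then $$\{\widetilde\lambda,\widetilde\mu\}_{\widetilde\omega}=\widetilde{\{\lambda,\mu\}}\qquad\text{for all }\lambda,\mu\in\Gamma(L),$$ and, equivalently, $$\langle\widetilde J,\widetilde\psi\wedge\widetilde\chi\rangle=\widetilde{\langle J,\psi\wedge\chi\rangle}\qquad\text{for all }\psi,\chi\in\Gamma(\mathsf J^1L)=\Omega^1_{\mathsf D}.$$ In particular both identities hold. -/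

import Mathlib

open scoped Manifold ContDiff

noncomputable section

namespace ContactGeom

open Bundle Set Filter Topology

set_option linter.unusedSectionVars false

/-! ### Hyperplane distributions and their normal bundle `L = TM / H` -/

section NormalBundle

variable {E : Type*} [NormedAddCommGroup E] [NormedSpace ℝ E] [FiniteDimensional ℝ E]
  {M : Type*} [TopologicalSpace M] [ChartedSpace E M] [IsManifold 𝓘(ℝ, E) ∞ M]

variable (E M) in
/-- A smooth hyperplane distribution `H ⊆ TM`: a family of subspaces of the tangent spaces that is
locally the kernel of a smooth, nowhere vanishing one-form. -/
structure HyperplaneDistribution where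
  space : ∀ x : M, Submodule ℝ (TangentSpace 𝓘(ℝ, E) x)
  exists_form : ∀ x₀ : M, ∃ U : Set M, IsOpen U ∧ x₀ ∈ U ∧
    ∃ α : ∀ x : M, TangentSpace 𝓘(ℝ, E) x →L[ℝ] Bundle.Trivial M ℝ x,
      ContMDiffOn 𝓘(ℝ, E) (𝓘(ℝ, E).prod 𝓘(ℝ, E →L[ℝ] ℝ)) ∞
        (fun x ↦ (TotalSpace.mk x (α x) : TotalSpace (E →L[ℝ] ℝ)
          (fun x : M ↦ TangentSpace 𝓘(ℝ, E) x →L[ℝ] Bundle.Trivial M ℝ x))) U ∧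
      ∀ x ∈ U, α x ≠ 0 ∧ space x = (α x).ker

namespace HyperplaneDistribution

/-- The normal bundle `L = TM / H` (its fibre at `x`). -/
def Normal (H : HyperplaneDistribution E M) (x : M) : Type _ :=
  TangentSpace 𝓘(ℝ, E) x ⧸ H.space x

variable (H : HyperplaneDistribution E M)

instance (x : M) : AddCommGroup (H.Normal x) :=
  inferInstanceAs (AddCommGroup (TangentSpace 𝓘(ℝ, E) x ⧸ H.space x))

instance (x : M) : Module ℝ (H.Normal x) :=
  inferInstanceAs (Module ℝ (TangentSpace 𝓘(ℝ, E) x ⧸ H.space x))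

instance (x : M) : TopologicalSpace (H.Normal x) :=
  inferInstanceAs (TopologicalSpace (TangentSpace 𝓘(ℝ, E) x ⧸ H.space x))

instance (x : M) : IsTopologicalAddGroup (H.Normal x) :=
  inferInstanceAs (IsTopologicalAddGroup (TangentSpace 𝓘(ℝ, E) x ⧸ H.space x))

instance (x : M) : ContinuousSMul ℝ (H.Normal x) :=
  inferInstanceAs (ContinuousSMul ℝ (TangentSpace 𝓘(ℝ, E) x ⧸ H.space x))

instance (x : M) : T2Space (H.Normal x) := by
  have : FiniteDimensional ℝ (TangentSpace 𝓘(ℝ, E) x) := inferInstanceAs (FiniteDimensional ℝ E)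
  have : T2Space (TangentSpace 𝓘(ℝ, E) x) := inferInstanceAs (T2Space E)
  have : IsClosed (H.space x : Set (TangentSpace 𝓘(ℝ, E) x)) :=
    Submodule.closed_of_finiteDimensional (H.space x)
  have := Submodule.t3_quotient_of_isClosed (H.space x)
  exact inferInstanceAs (T2Space (TangentSpace 𝓘(ℝ, E) x ⧸ H.space x))

instance (x : M) : FiniteDimensional ℝ (H.Normal x) := by
  have : FiniteDimensional ℝ (TangentSpace 𝓘(ℝ, E) x) := inferInstanceAs (FiniteDimensional ℝ E)
  exact inferInstanceAs (FiniteDimensional ℝ (TangentSpace 𝓘(ℝ, E) x ⧸ H.space x))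

/-- The canonical projection `θ_H : T_x M → L_x`. -/
def theta (x : M) : TangentSpace 𝓘(ℝ, E) x →ₗ[ℝ] H.Normal x := (H.space x).mkQ

/-- A functional on `T_x M` that vanishes on `H_x` descends to `L_x`. -/
def normalLift {x : M} (f : TangentSpace 𝓘(ℝ, E) x →ₗ[ℝ] ℝ) (h : H.space x ≤ f.ker) :
    H.Normal x →ₗ[ℝ] ℝ :=
  (H.space x).liftQ f h

theorem normalLift_theta {x : M} (f : TangentSpace 𝓘(ℝ, E) x →ₗ[ℝ] ℝ) (h : H.space x ≤ f.ker)
    (v : TangentSpace 𝓘(ℝ, E) x) : H.normalLift f h (H.theta x v) = f v :=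
  Submodule.liftQ_apply (H.space x) f v

/-- A local defining form of `H`: a smooth nowhere vanishing form on an open set with kernel `H`. -/
structure LocalForm where
  dom : Set M
  isOpen_dom : IsOpen dom
  form : ∀ x : M, TangentSpace 𝓘(ℝ, E) x →L[ℝ] Bundle.Trivial M ℝ x
  smooth : ContMDiffOn 𝓘(ℝ, E) (𝓘(ℝ, E).prod 𝓘(ℝ, E →L[ℝ] ℝ)) ∞
        (fun x ↦ (TotalSpace.mk x (form x) : TotalSpace (E →L[ℝ] ℝ)
          (fun x : M ↦ TangentSpace 𝓘(ℝ, E) x →L[ℝ] Bundle.Trivial M ℝ x))) dom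
  ne_zero : ∀ x ∈ dom, form x ≠ 0
  ker_eq : ∀ x ∈ dom, H.space x = (form x).ker

theorem exists_localForm (x₀ : M) : ∃ α : H.LocalForm, x₀ ∈ α.dom := by
  obtain ⟨U, hU, hx, α, hs, h⟩ := H.exists_form x₀
  exact ⟨⟨U, hU, α, hs, fun x hx ↦ (h x hx).1, fun x hx ↦ (h x hx).2⟩, hx⟩

namespace LocalForm

variable {H} (α β : H.LocalForm)

/-- The map `L_x → ℝ` induced by a local defining form (zero outside the domain). -/
def desc (x : M) : H.Normal x →ₗ[ℝ] ℝ :=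
  open Classical in
  if h : x ∈ α.dom then H.normalLift (α.form x).toLinearMap (α.ker_eq x h).le else 0

theorem desc_theta {x : M} (h : x ∈ α.dom) (v : TangentSpace 𝓘(ℝ, E) x) :
    α.desc x (H.theta x v) = α.form x v := by
  rw [desc, dif_pos h]
  exact H.normalLift_theta _ _ v

theorem theta_surjective (x : M) : Function.Surjective (H.theta x) :=
  Submodule.mkQ_surjective _

theorem desc_bijective {x : M} (h : x ∈ α.dom) : Function.Bijective (α.desc x) := by
  constructor
  · rw [injective_iff_map_eq_zero]
    intro l hl
    obtain ⟨v, rfl⟩ := theta_surjective x l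
    rw [desc_theta α h] at hl
    have : v ∈ H.space x := by rw [α.ker_eq x h]; exact hl
    exact (Submodule.Quotient.mk_eq_zero _).2 this
  · have : α.desc x ≠ 0 := by
      intro h0
      apply α.ne_zero x h
      ext v
      have := desc_theta α h v
      rw [h0] at this
      exact this.symm
    exact LinearMap.surjective this

/-- The linear isomorphism `L_x ≃ ℝ` induced by a local defining form. -/
def equiv {x : M} (h : x ∈ α.dom) : H.Normal x ≃ₗ[ℝ] ℝ :=
  LinearEquiv.ofBijective (α.desc x) (α.desc_bijective h)

/-- The vector of `L_x` on which the local form takes the value `1`. -/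
def gen (x : M) : H.Normal x :=
  open Classical in if h : x ∈ α.dom then (α.equiv h).symm 1 else 0

theorem desc_gen {x : M} (h : x ∈ α.dom) : α.desc x (α.gen x) = 1 := by
  simp only [gen, h, dif_pos]
  exact (α.equiv h).apply_symm_apply 1

theorem desc_smul_gen {x : M} (h : x ∈ α.dom) (l : H.Normal x) : α.desc x l • α.gen x = l := by
  apply (α.desc_bijective h).1
  simp [desc_gen α h]

/-- The pretrivialization of the normal bundle given by a local defining form. -/
def pretrivialization : Pretrivialization ℝ (π ℝ H.Normal) where
  toFun p := (p.1, α.desc p.1 p.2)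
  invFun q := ⟨q.1, q.2 • α.gen q.1⟩
  source := π ℝ H.Normal ⁻¹' α.dom
  target := α.dom ×ˢ univ
  map_source' p hp := ⟨hp, mem_univ _⟩
  map_target' q hq := hq.1
  left_inv' p hp := by
    rcases p with ⟨x, l⟩
    simp [desc_smul_gen α (x := x) hp l]
  right_inv' q hq := by
    rcases q with ⟨x, t⟩
    simp [desc_gen α (x := x) hq.1]
  open_target := α.isOpen_dom.prod isOpen_univ
  baseSet := α.dom
  open_baseSet := α.isOpen_dom
  source_eq := rfl
  target_eq := rfl
  proj_toFun p hp := rfl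

theorem pretrivialization_apply (p : TotalSpace ℝ H.Normal) :
    α.pretrivialization p = (p.1, α.desc p.1 p.2) := rfl

theorem pretrivialization_symm {x : M} (h : x ∈ α.dom) (t : ℝ) :
    α.pretrivialization.symm x t = t • α.gen x := by
  have h1 : α.pretrivialization (TotalSpace.mk x (α.pretrivialization.symm x t)) = (x, t) :=
    α.pretrivialization.apply_mk_symm h t
  have h2 : α.desc x (α.pretrivialization.symm x t) = t := congrArg Prod.snd h1
  apply (α.desc_bijective h).1
  simp [h2, desc_gen α h]

/-- The form `α` evaluated on a smooth vector field is smooth. -/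
theorem contMDiffAt_apply {x : M} (h : x ∈ α.dom) {V : ∀ x : M, TangentSpace 𝓘(ℝ, E) x}
    (hV : ContMDiffAt 𝓘(ℝ, E) 𝓘(ℝ, E).tangent ∞
      (fun y ↦ (TotalSpace.mk y (V y) : TangentBundle 𝓘(ℝ, E) M)) x) :
    ContMDiffAt 𝓘(ℝ, E) 𝓘(ℝ) ∞ (fun y ↦ (α.form y (V y) : ℝ)) x := by
  have h1 := α.smooth.contMDiffAt (α.isOpen_dom.mem_nhds h)
  have h2 := ContMDiffAt.clm_bundle_apply (n := ∞) h1 hV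
  rw [contMDiffAt_totalSpace] at h2
  exact h2.2

theorem contMDiffAt_ratio {x : M} (h : x ∈ α.dom) (h' : x ∈ β.dom) :
    ContMDiffAt 𝓘(ℝ, E) 𝓘(ℝ) ∞ (fun y ↦ β.desc y (α.gen y)) x := by
  obtain ⟨v, hv⟩ := theta_surjective x (α.gen x)
  set V := FiberBundle.extend E (E := (TangentSpace 𝓘(ℝ, E) : M → Type _)) v with hVdef
  have hV : ContMDiffAt 𝓘(ℝ, E) 𝓘(ℝ, E).tangent ∞
      (fun y ↦ (TotalSpace.mk y (V y) : TangentBundle 𝓘(ℝ, E) M)) x := by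
    exact FiberBundle.contMDiffAt_extend _ _ v
  have hA := α.contMDiffAt_apply h hV
  have hB := β.contMDiffAt_apply h' hV
  have hx1 : (α.form x (V x) : ℝ) = 1 := by
    rw [hVdef, FiberBundle.extend_apply_self, ← desc_theta α h, hv, desc_gen α h]
  have key : (fun y ↦ β.desc y (α.gen y)) =ᶠ[𝓝 x]
      fun y ↦ (β.form y (V y) : ℝ) * (α.form y (V y) : ℝ)⁻¹ := by
    have hne : ∀ᶠ y in 𝓝 x, (α.form y (V y) : ℝ) ≠ 0 :=
      hA.continuousAt.eventually_ne (by rw [hx1]; exact one_ne_zero)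
    filter_upwards [hne, α.isOpen_dom.mem_nhds h, β.isOpen_dom.mem_nhds h'] with y hy ha hb
    rw [← desc_theta α ha] at hy ⊢
    rw [← desc_theta β hb]
    conv_rhs => rw [← desc_smul_gen α ha (H.theta y (V y)), map_smul, map_smul, desc_gen α ha]
    simp
    field_simp
  refine ContMDiffAt.congr_of_eventuallyEq ?_ key
  have : (α.form x (V x) : ℝ) ≠ 0 := by rw [hx1]; exact one_ne_zero
  exact hB.mul (hA.inv₀ this)

end LocalForm

theorem exists_coordChange (α β : H.LocalForm) :
    ∃ f : M → ℝ →L[ℝ] ℝ, ContMDiffOn 𝓘(ℝ, E) 𝓘(ℝ, ℝ →L[ℝ] ℝ) ∞ f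
        (α.pretrivialization.baseSet ∩ β.pretrivialization.baseSet) ∧
      ∀ b ∈ α.pretrivialization.baseSet ∩ β.pretrivialization.baseSet, ∀ v : ℝ,
        f b v = (β.pretrivialization ⟨b, α.pretrivialization.symm b v⟩).2 := by
  refine ⟨fun b ↦ (β.desc b (α.gen b)) • ContinuousLinearMap.id ℝ ℝ, ?_, ?_⟩
  · intro x hx
    exact ((α.contMDiffAt_ratio β hx.1 hx.2).smul contMDiffAt_const).contMDiffWithinAt
  · intro b hb v
    rw [α.pretrivialization_symm hb.1, LocalForm.pretrivialization_apply]
    simp [mul_comm]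

/-- The vector bundle structure of `L = TM / H`: the local trivializations are those given by the
local defining forms of `H`. -/
def vectorPrebundle : VectorPrebundle ℝ ℝ H.Normal where
  pretrivializationAtlas := range LocalForm.pretrivialization
  pretrivialization_linear' := by
    rintro _ ⟨α, rfl⟩
    exact ⟨fun x _ ↦ (α.desc x).isLinear⟩
  pretrivializationAt x := (H.exists_localForm x).choose.pretrivialization
  mem_base_pretrivializationAt x := (H.exists_localForm x).choose_spec
  pretrivialization_mem_atlas x := mem_range_self _
  exists_coordChange := by
    rintro _ ⟨α, rfl⟩ _ ⟨β, rfl⟩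
    obtain ⟨f, hf, h⟩ := H.exists_coordChange α β
    exact ⟨f, hf.continuousOn, h⟩
  totalSpaceMk_isInducing x := by
    set α := (H.exists_localForm x).choose
    have hx : x ∈ α.dom := (H.exists_localForm x).choose_spec
    have h1 : IsInducing (α.equiv hx) :=
      (α.equiv hx).toContinuousLinearEquiv.toHomeomorph.isInducing
    have h2 : (α.pretrivialization ∘ TotalSpace.mk x) = fun l ↦ (x, α.equiv hx l) := rfl
    rw [h2]
    exact (isInducing_const_prod.2 h1)

instance : TopologicalSpace (TotalSpace ℝ H.Normal) := H.vectorPrebundle.totalSpaceTopology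

instance : FiberBundle ℝ H.Normal := H.vectorPrebundle.toFiberBundle

instance : VectorBundle ℝ ℝ H.Normal := H.vectorPrebundle.toVectorBundle

instance : H.vectorPrebundle.IsContMDiff 𝓘(ℝ, E) ∞ where
  exists_contMDiffCoordChange := by
    rintro _ ⟨α, rfl⟩ _ ⟨β, rfl⟩
    exact H.exists_coordChange α β

instance : ContMDiffVectorBundle ∞ ℝ H.Normal 𝓘(ℝ, E) :=
  H.vectorPrebundle.contMDiffVectorBundle 𝓘(ℝ, E)

theorem contMDiffAt_theta {x : M} {V : ∀ x : M, TangentSpace 𝓘(ℝ, E) x}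
    (hV : ContMDiffAt 𝓘(ℝ, E) 𝓘(ℝ, E).tangent ∞
      (fun y ↦ (TotalSpace.mk y (V y) : TangentBundle 𝓘(ℝ, E) M)) x) :
    ContMDiffAt 𝓘(ℝ, E) (𝓘(ℝ, E).prod 𝓘(ℝ, ℝ)) ∞
      (fun y ↦ (TotalSpace.mk y (H.theta y (V y)) : TotalSpace ℝ H.Normal)) x := by
  rw [contMDiffAt_section]
  have hx : x ∈ (H.exists_localForm x).choose.dom := (H.exists_localForm x).choose_spec
  refine ((H.exists_localForm x).choose.contMDiffAt_apply hx hV).congr_of_eventuallyEq ?_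
  filter_upwards [(H.exists_localForm x).choose.isOpen_dom.mem_nhds hx] with y hy
  exact LocalForm.desc_theta _ hy (V y)

end HyperplaneDistribution

end NormalBundle

/-! ### The module of smooth sections, vector fields and their Lie bracket -/

section Sections

variable {E : Type*} [NormedAddCommGroup E] [NormedSpace ℝ E]
  {B : Type*} [TopologicalSpace B] {I : ModelWithCorners ℝ E B}
  {N : Type*} [TopologicalSpace N] [ChartedSpace B N]
  {F : Type*} [NormedAddCommGroup F] [NormedSpace ℝ F]
  {V : N → Type*} [TopologicalSpace (TotalSpace F V)] [∀ x, AddCommGroup (V x)]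
  [∀ x, Module ℝ (V x)] [∀ x, TopologicalSpace (V x)] [FiberBundle F V] [VectorBundle ℝ F V]

/-- Smooth sections form a module over the smooth functions, by pointwise multiplication. -/
instance sectionSMul : SMul C^∞⟮I, N; ℝ⟯ Cₛ^∞⟮I; F, V⟯ :=
  ⟨fun f s ↦ ⟨fun x ↦ f x • s x, f.contMDiff.smul_section s.contMDiff⟩⟩

theorem smul_section_apply (f : C^∞⟮I, N; ℝ⟯) (s : Cₛ^∞⟮I; F, V⟯) (x : N) :
    (f • s) x = f x • s x := rfl

instance sectionModule : Module C^∞⟮I, N; ℝ⟯ Cₛ^∞⟮I; F, V⟯ where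
  one_smul s := by ext x; exact one_smul ℝ (s x)
  mul_smul f g s := by ext x; exact mul_smul (f x) (g x) (s x)
  smul_zero f := by ext x; exact smul_zero (f x)
  smul_add f s t := by ext x; exact smul_add (f x) (s x) (t x)
  add_smul f g s := by ext x; exact add_smul (f x) (g x) (s x)
  zero_smul s := by ext x; exact zero_smul ℝ (s x)

instance sectionSMulCommClass : SMulCommClass ℝ C^∞⟮I, N; ℝ⟯ Cₛ^∞⟮I; F, V⟯ where
  smul_comm c f s := by ext x; exact smul_comm c (f x) (s x)

end Sections

section VectorFields

variable {E : Type*} [NormedAddCommGroup E] [NormedSpace ℝ E]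
  {B : Type*} [TopologicalSpace B] {I : ModelWithCorners ℝ E B}
  {N : Type*} [TopologicalSpace N] [ChartedSpace B N] [IsManifold I ∞ N]

variable (I N) in
/-- Smooth vector fields on `N`. -/
abbrev VecField := Cₛ^∞⟮I; E, (TangentSpace I : N → Type _)⟯

/-- The derivative `X(f)` of a smooth function along a smooth vector field. -/
def VecField.deriv (X : VecField I N) (f : C^∞⟮I, N; ℝ⟯) : C^∞⟮I, N; ℝ⟯ :=
  ⟨fun p ↦ mvfderiv I f p (X p), by
    have h1 : ContMDiff I.tangent 𝓘(ℝ, ℝ).tangent ∞ (tangentMap I 𝓘(ℝ, ℝ) f) :=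
      f.contMDiff.contMDiff_tangentMap le_rfl
    exact (contMDiff_snd_tangentBundle_modelSpace ℝ 𝓘(ℝ, ℝ)).comp (h1.comp X.contMDiff)⟩

theorem VecField.deriv_apply (X : VecField I N) (f : C^∞⟮I, N; ℝ⟯) (p : N) :
    X.deriv f p = mvfderiv I f p (X p) := rfl

theorem fderivWithin_comp_extChartAt_symm {x : N} {g : N → ℝ} {y : E}
    (hy : y ∈ (extChartAt I x).target)
    (hg : MDifferentiableAt I 𝓘(ℝ, ℝ) g ((extChartAt I x).symm y)) (w : E) :
    fderivWithin ℝ (g ∘ (extChartAt I x).symm) (range I) y w =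
      mvfderiv I g ((extChartAt I x).symm y)
        (mfderivWithin 𝓘(ℝ, E) I (extChartAt I x).symm (range I) y w) := by
  have h1 : MDifferentiableWithinAt 𝓘(ℝ, E) I (extChartAt I x).symm (range I) y :=
    mdifferentiableWithinAt_extChartAt_symm hy
  have h2 := mvfderiv_comp_mfderivWithin (I := I) (I' := 𝓘(ℝ, E)) (f := (extChartAt I x).symm)
    (s := range I) y hg h1 (I.uniqueMDiffOn y (extChartAt_target_subset_range x hy))
  have h3 : mvfderivWithin 𝓘(ℝ, E) (g ∘ (extChartAt I x).symm) (range I) y =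
      fderivWithin ℝ (g ∘ (extChartAt I x).symm) (range I) y := mfderivWithin_eq_fderivWithin
  rw [← h3]
  exact congrArg (fun L ↦ L w) h2

theorem fderivWithin_comp_pullback [CompleteSpace E] {x : N} {g : N → ℝ} {y : E}
    (hy : y ∈ (extChartAt I x).target)
    (hg : MDifferentiableAt I 𝓘(ℝ, ℝ) g ((extChartAt I x).symm y))
    (X : ∀ p : N, TangentSpace I p) :
    fderivWithin ℝ (g ∘ (extChartAt I x).symm) (range I) y
        (VectorField.mpullbackWithin 𝓘(ℝ, E) I (extChartAt I x).symm X (range I) y) =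
      mvfderiv I g ((extChartAt I x).symm y) (X ((extChartAt I x).symm y)) := by
  refine (fderivWithin_comp_extChartAt_symm hy hg _).trans ?_
  refine congrArg (mvfderiv I g ((extChartAt I x).symm y)) ?_
  exact (isInvertible_mfderivWithin_extChartAt_symm hy).self_apply_inverse _

variable [CompleteSpace E]

/-- The Lie bracket of smooth vector fields. -/
def VecField.bracket (X Y : VecField I N) : VecField I N :=
  ⟨VectorField.mlieBracket I X Y, by
    have : IsManifold I (minSmoothness ℝ 2) N := by
      rw [minSmoothness_of_isRCLikeNormedField]; infer_instance
    have : IsManifold I (minSmoothness ℝ 3) N := by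
      rw [minSmoothness_of_isRCLikeNormedField]; infer_instance
    have : IsManifold I (((⊤ : ℕ∞) : ℕ∞ω) + 1) N := inferInstanceAs (IsManifold I ∞ N)
    intro x
    refine ContMDiffAt.mlieBracket_vectorField (n := ⊤) (m := ⊤) (X.contMDiff x) (Y.contMDiff x) ?_
    rw [minSmoothness_of_isRCLikeNormedField]; simp⟩

theorem VecField.bracket_apply (X Y : VecField I N) (p : N) :
    X.bracket Y p = VectorField.mlieBracket I X Y p := rfl

theorem VecField.bracket_swap (X Y : VecField I N) : X.bracket Y = -Y.bracket X := by
  ext p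
  exact VectorField.mlieBracket_swap_apply

theorem VecField.bracket_self (X : VecField I N) : X.bracket X = 0 := by
  ext p
  exact congrFun VectorField.mlieBracket_self p

theorem VecField.bracket_add_right (X Y Z : VecField I N) :
    X.bracket (Y + Z) = X.bracket Y + X.bracket Z := by
  ext p
  exact VectorField.mlieBracket_add_right Y.mdifferentiableAt Z.mdifferentiableAt

theorem VecField.bracket_smul_right (X Y : VecField I N) (f : C^∞⟮I, N; ℝ⟯) :
    X.bracket (f • Y) = X.deriv f • Y + f • X.bracket Y := by
  ext p
  exact VectorField.mlieBracket_smul_right (f.contMDiff.mdifferentiableAt (by simp))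
    Y.mdifferentiableAt

/-- The Lie bracket of vector fields acts on functions as the commutator. -/
theorem VecField.deriv_bracket (X Y : VecField I N) (f : C^∞⟮I, N; ℝ⟯) :
    (X.bracket Y).deriv f = X.deriv (Y.deriv f) - Y.deriv (X.deriv f) := by
  have : IsManifold I (1 + 1) N := inferInstanceAs (IsManifold I 2 N)
  ext x
  set φ := extChartAt I x with hφ
  have hx : φ x ∈ φ.target := mem_extChartAt_target x
  have hxx : φ.symm (φ x) = x := extChartAt_to_inv x
  have hd (g : C^∞⟮I, N; ℝ⟯) (p : N) : MDifferentiableAt I 𝓘(ℝ, ℝ) g p :=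
    g.contMDiff.mdifferentiableAt (by simp)
  set X' := VectorField.mpullbackWithin 𝓘(ℝ, E) I φ.symm X (range I) with hX'
  set Y' := VectorField.mpullbackWithin 𝓘(ℝ, E) I φ.symm Y (range I) with hY'
  have key (Z : VecField I N) (g : C^∞⟮I, N; ℝ⟯) {y : E} (hy : y ∈ φ.target) :
      fderivWithin ℝ (g ∘ φ.symm) (range I) y
        (VectorField.mpullbackWithin 𝓘(ℝ, E) I φ.symm Z (range I) y) =
      (Z.deriv g) (φ.symm y) := fderivWithin_comp_pullback hy (hd g _) Z
  have hdiff (Z : VecField I N) : DifferentiableWithinAt ℝ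
      (VectorField.mpullbackWithin 𝓘(ℝ, E) I φ.symm Z (range I)) (range I) (φ x) := by
    have h := (Z.mdifferentiableAt (x := x)).mdifferentiableWithinAt (s := univ)
      |>.differentiableWithinAt_mpullbackWithin_vectorField
    rw [preimage_univ, univ_inter] at h
    exact h
  have hcong (Z W : VecField I N) :
      fderivWithin ℝ (fun y ↦ fderivWithin ℝ (f ∘ φ.symm) (range I) y
        (VectorField.mpullbackWithin 𝓘(ℝ, E) I φ.symm Z (range I) y)) (range I) (φ x)
        (VectorField.mpullbackWithin 𝓘(ℝ, E) I φ.symm W (range I) (φ x)) =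
      W.deriv (Z.deriv f) x := by
    have h1 : (fun y ↦ fderivWithin ℝ (f ∘ φ.symm) (range I) y
        (VectorField.mpullbackWithin 𝓘(ℝ, E) I φ.symm Z (range I) y))
        =ᶠ[𝓝[range I] (φ x)] (Z.deriv f) ∘ φ.symm := by
      filter_upwards [extChartAt_target_mem_nhdsWithin (I := I) x] with y hy
      exact key Z f hy
    rw [h1.fderivWithin_eq_of_mem (mem_range_self _), key W _ hx, hxx]
  have hsm : ContDiffWithinAt ℝ ∞ (f ∘ φ.symm) (range I) (φ x) := by
    have h1 := (f.contMDiff x).comp_contMDiffWithinAt_of_eq (f := φ.symm) (s := range I)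
      (contMDiffWithinAt_extChartAt_symm_range_self (n := ∞) x) hxx
    exact h1.contDiffWithinAt
  have main := VectorField.fderivWithin_apply_lieBracket (𝕜 := ℝ) (V := X') (W := Y') hsm
    (by rw [minSmoothness_of_isRCLikeNormedField]; exact WithTop.coe_le_coe.2 (le_top : (2 : ℕ∞) ≤ ⊤)) I.uniqueDiffOn
    (I.range_subset_closure_interior (mem_range_self _)) (mem_range_self _)
    (hdiff Y) (hdiff X)
  rw [hcong Y X, hcong X Y] at main
  rw [ContMDiffMap.coe_sub, Pi.sub_apply, ← main, VecField.deriv_apply,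
    VecField.bracket_apply]
  have hmfd (w : E) (p : N) (hp : φ.symm (φ x) = p) :
      fderivWithin ℝ (f ∘ φ.symm) (range I) (φ x) w =
        mvfderiv I f p (mfderivWithin 𝓘(ℝ, E) I φ.symm (range I) (φ x) w : E) := by
    subst hp
    exact fderivWithin_comp_extChartAt_symm hx (hd f _) w
  refine Eq.trans ?_ (hmfd _ x hxx).symm
  refine congrArg (mvfderiv I f x) ?_
  have hinv : (mfderiv I 𝓘(ℝ, E) φ x : E →L[ℝ] E).inverse =
      (mfderivWithin 𝓘(ℝ, E) I φ.symm (range I) (φ x) : E →L[ℝ] E) :=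
    ContinuousLinearMap.inverse_eq
      (mfderiv_extChartAt_comp_mfderivWithin_extChartAt_symm' (mem_extChartAt_source x))
      (mfderivWithin_extChartAt_symm_comp_mfderiv_extChartAt' (mem_extChartAt_source x))
  rw [VectorField.mlieBracket, VectorField.mlieBracketWithin, preimage_univ, univ_inter]
  exact congrArg (fun L : E →L[ℝ] E ↦
    L (VectorField.lieBracketWithin ℝ X' Y' (range I) (φ x))) hinv

end VectorFields

/-! ### Forms on a manifold, inverse of a two-form, Poisson bracket -/

section Poisson

variable {E : Type*} [NormedAddCommGroup E] [NormedSpace ℝ E]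
  {B : Type*} [TopologicalSpace B] (I : ModelWithCorners ℝ E B)
  (N : Type*) [TopologicalSpace N] [ChartedSpace B N] [IsManifold I ∞ N]

/-- Differential one-forms: pointwise linear, and smooth on every smooth vector field. -/
structure DiffOneForm where
  toFun : ∀ p : N, TangentSpace I p →ₗ[ℝ] ℝ
  smooth : ∀ X : VecField I N, ContMDiff I 𝓘(ℝ, ℝ) ∞ fun p ↦ toFun p (X p)

/-- Differential two-forms: pointwise bilinear and alternating, and smooth on every pair of smooth
vector fields. -/
structure DiffTwoForm where
  toFun : ∀ p : N, TangentSpace I p →ₗ[ℝ] TangentSpace I p →ₗ[ℝ] ℝ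
  alt : ∀ p v, toFun p v v = 0
  smooth : ∀ X Y : VecField I N, ContMDiff I 𝓘(ℝ, ℝ) ∞ fun p ↦ toFun p (X p) (Y p)

instance : Nonempty (DiffOneForm I N) := ⟨⟨fun _ ↦ 0, fun _ ↦ contMDiff_const⟩⟩

instance : Nonempty (DiffTwoForm I N) :=
  ⟨⟨fun _ ↦ 0, fun _ _ ↦ rfl, fun _ _ ↦ contMDiff_const⟩⟩

variable {I N}

/-- For a non-degenerate form `η` and a covector `α` at `p`: the unique tangent vector `v` such
that `η(v, -) = α`. -/
def DiffTwoForm.sharp (η : DiffTwoForm I N) (p : N) (α : TangentSpace I p →ₗ[ℝ] ℝ) :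
    TangentSpace I p :=
  Classical.epsilon fun v ↦ η.toFun p v = α

/-- The bivector `η⁻¹`, that is `η⁻¹(α, β) = η(α♯, β♯)` where `η(α♯, -) = α`. -/
def DiffTwoForm.poissonTensor (η : DiffTwoForm I N) (p : N)
    (α β : TangentSpace I p →ₗ[ℝ] ℝ) : ℝ :=
  η.toFun p (η.sharp p α) (η.sharp p β)

/-- The Hamiltonian vector field `X_f` of a function on a symplectic manifold,
`η(X_f, -) = df`. -/
def DiffTwoForm.hamiltonian (η : DiffTwoForm I N) (f : C^∞⟮I, N; ℝ⟯) (p : N) : TangentSpace I p :=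
  η.sharp p (mvfderiv I f p).toLinearMap

/-- The Poisson bracket `{f, g} = η(X_f, X_g)` of a symplectic manifold. -/
def DiffTwoForm.poissonBracket (η : DiffTwoForm I N) (f g : C^∞⟮I, N; ℝ⟯) (p : N) : ℝ :=
  η.toFun p (η.hamiltonian f p) (η.hamiltonian g p)

end Poisson

/-! ### Contact structures, Jacobi bracket, gauge algebroid, Atiyah forms -/

section Contact

variable {E : Type*} [NormedAddCommGroup E] [NormedSpace ℝ E] [FiniteDimensional ℝ E]
  {M : Type*} [TopologicalSpace M] [ChartedSpace E M] [IsManifold 𝓘(ℝ, E) ∞ M]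

instance : CompleteSpace E := FiniteDimensional.complete ℝ E

namespace HyperplaneDistribution

variable (H : HyperplaneDistribution E M)

/-- The sections `Γ(L)` of the normal bundle. -/
abbrev NormalSection := Cₛ^∞⟮𝓘(ℝ, E); ℝ, H.Normal⟯

/-- The projection `θ_H` on sections. -/
def thetaSection : VecField 𝓘(ℝ, E) M →ₗ[C^∞⟮𝓘(ℝ, E), M; ℝ⟯] H.NormalSection where
  toFun X := ⟨fun x ↦ H.theta x (X x), fun x ↦ H.contMDiffAt_theta (X.contMDiff x)⟩
  map_add' X Y := by ext x; exact map_add (H.theta x) (X x) (Y x)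
  map_smul' f X := by ext x; exact map_smul (H.theta x) (f x) (X x)

/-- The vector field `X` is a section of `H`. -/
def IsHorizontal (X : VecField 𝓘(ℝ, E) M) : Prop := ∀ x, X x ∈ H.space x

/-- The curvature `(X, Y) ↦ [X, Y] mod H` of `H` on sections of `H`. -/
def curvature (X Y : VecField 𝓘(ℝ, E) M) : H.NormalSection := H.thetaSection (X.bracket Y)

/-- `H` is a contact structure: its curvature is non-degenerate at every point. (The curvature is
tensorial, and every vector of `H` extends to a section of `H`.) -/
def IsContact : Prop :=
  ∀ (x : M) (X : VecField 𝓘(ℝ, E) M), H.IsHorizontal X →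
    (∀ Y : VecField 𝓘(ℝ, E) M, H.IsHorizontal Y → H.curvature X Y x = 0) → X x = 0

/-- Contact vector fields, i.e. infinitesimal symmetries of `H`: `[X, Γ(H)] ⊆ Γ(H)`. -/
def IsContactVecField (X : VecField 𝓘(ℝ, E) M) : Prop :=
  ∀ Y : VecField 𝓘(ℝ, E) M, H.IsHorizontal Y → H.IsHorizontal (X.bracket Y)

/-- The Hamiltonian vector field `X_λ` of a section `λ` of the normal bundle of a contact structure:
the unique contact vector field such that `θ_H(X_λ) = λ`. -/
def hamiltonianVecField (l : H.NormalSection) : VecField 𝓘(ℝ, E) M :=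
  Classical.epsilon fun X ↦ H.IsContactVecField X ∧ H.thetaSection X = l

/-- The Jacobi bracket `{λ, μ} = θ_H([X_λ, X_μ])`. -/
def jacobiBracket (l m : H.NormalSection) : H.NormalSection :=
  H.thetaSection ((H.hamiltonianVecField l).bracket (H.hamiltonianVecField m))

/-- The derivations of `L`, as a module over the smooth functions: `ℝ`-linear operators `D` on
`Γ(L)` such that `D(f λ) = X(f) λ + f D(λ)` for a vector field `X`. As the symbol `X` is determined
by `D`, it is kept along with `D`. -/
def derSubmodule : Submodule C^∞⟮𝓘(ℝ, E), M; ℝ⟯ ((H.NormalSection →ₗ[ℝ] H.NormalSection) × VecField 𝓘(ℝ, E) M) where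
  carrier := {D | ∀ (f : C^∞⟮𝓘(ℝ, E), M; ℝ⟯) (l : H.NormalSection), D.1 (f • l) = D.2.deriv f • l + f • D.1 l}
  zero_mem' := by
    intro f l
    ext x
    simp [smul_section_apply, VecField.deriv_apply]
  add_mem' := by
    intro D D' hD hD' f l
    ext x
    have h1 := congrArg (fun s : H.NormalSection ↦ s x) (hD f l)
    have h2 := congrArg (fun s : H.NormalSection ↦ s x) (hD' f l)
    simp only [ContMDiffSection.coe_add, Pi.add_apply, smul_section_apply, VecField.deriv_apply,
      Prod.fst_add, Prod.snd_add, LinearMap.add_apply, map_add, add_smul, smul_add] at h1 h2 ⊢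
    rw [h1, h2]
    abel
  smul_mem' := by
    intro g D hD f l
    ext x
    have h1 := congrArg (fun s : H.NormalSection ↦ s x) (hD f l)
    simp only [ContMDiffSection.coe_add, Pi.add_apply, smul_section_apply, VecField.deriv_apply,
      Prod.smul_fst, Prod.smul_snd, LinearMap.smul_apply, map_smul] at h1 ⊢
    rw [h1, smul_add, smul_smul, smul_smul, smul_smul, smul_eq_mul, mul_comm (g x) (f x)]

/-- The derivations of `L`, i.e. the sections `Γ(DL)` of the gauge algebroid. -/
abbrev Der : Type _ := H.derSubmodule

variable {H}

/-- The action of a derivation on sections. -/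
def Der.apply (D : H.Der) (l : H.NormalSection) : H.NormalSection := D.1.1 l

/-- The symbol `σ(D)`. -/
def Der.symbol (D : H.Der) : VecField 𝓘(ℝ, E) M := D.1.2

theorem Der.leibniz (D : H.Der) (f : C^∞⟮𝓘(ℝ, E), M; ℝ⟯) (l : H.NormalSection) :
    D.apply (f • l) = D.symbol.deriv f • l + f • D.apply l := D.2 f l

/-- The commutator of derivations. -/
def Der.bracket (D D' : H.Der) : H.Der :=
  ⟨(D.1.1 ∘ₗ D'.1.1 - D'.1.1 ∘ₗ D.1.1, D.symbol.bracket D'.symbol), by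
    intro f l
    change D.apply (D'.apply (f • l)) - D'.apply (D.apply (f • l)) =
      (D.symbol.bracket D'.symbol).deriv f • l +
        f • (D.apply (D'.apply l) - D'.apply (D.apply l))
    have hadd (D : H.Der) (a b : H.NormalSection) : D.apply (a + b) = D.apply a + D.apply b :=
      map_add D.1.1 a b
    rw [VecField.deriv_bracket, D.leibniz, D'.leibniz, hadd, hadd, D.leibniz, D.leibniz,
      D'.leibniz, D'.leibniz, sub_smul, smul_sub]
    abel⟩

theorem Der.ext' {D D' : H.Der} (h : ∀ l, D.apply l = D'.apply l) (h' : D.symbol = D'.symbol) :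
    D = D' :=
  Subtype.ext (Prod.ext (LinearMap.ext h) h')

theorem Der.bracket_swap (D D' : H.Der) : D.bracket D' = -D'.bracket D := by
  refine Der.ext' (fun l ↦ ?_) ?_
  · exact (neg_sub (D'.apply (D.apply l)) (D.apply (D'.apply l))).symm
  · exact VecField.bracket_swap _ _

theorem Der.bracket_add_right (D D' D'' : H.Der) :
    D.bracket (D' + D'') = D.bracket D' + D.bracket D'' := by
  refine Der.ext' (fun l ↦ ?_) (VecField.bracket_add_right _ _ _)
  have hadd (a b : H.NormalSection) : D.apply (a + b) = D.apply a + D.apply b := map_add D.1.1 a b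
  change D.apply (D'.apply l + D''.apply l) - (D'.apply (D.apply l) + D''.apply (D.apply l)) =
    D.apply (D'.apply l) - D'.apply (D.apply l) + (D.apply (D''.apply l) - D''.apply (D.apply l))
  rw [hadd]
  abel

theorem Der.bracket_smul_right (D D' : H.Der) (f : C^∞⟮𝓘(ℝ, E), M; ℝ⟯) :
    D.bracket (f • D') = D.symbol.deriv f • D' + f • D.bracket D' := by
  refine Der.ext' (fun l ↦ ?_) (VecField.bracket_smul_right _ _ _)
  change D.apply (f • D'.apply l) - f • D'.apply (D.apply l) =
    D.symbol.deriv f • D'.apply l + f • (D.apply (D'.apply l) - D'.apply (D.apply l))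
  rw [D.leibniz, smul_sub]
  abel

variable (H)

/-- Atiyah one-forms `Ω¹_D = Γ(Hom(DL, L))`, which are the sections `Γ(J¹L)` of the first jet
bundle. -/
abbrev AtiyahOneForm := H.Der →ₗ[C^∞⟮𝓘(ℝ, E), M; ℝ⟯] H.NormalSection

/-- The first jet prolongation `j¹λ`, i.e. `D ↦ D(λ)`. -/
def jet (l : H.NormalSection) : H.AtiyahOneForm where
  toFun D := D.apply l
  map_add' _ _ := rfl
  map_smul' _ _ := rfl

end HyperplaneDistribution

/-- Alternating bilinear maps `∧²A → B` of modules. -/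
structure AlternatingTwoForm (R A B : Type*) [CommRing R] [AddCommGroup A] [Module R A]
    [AddCommGroup B] [Module R B] where
  toBilin : A →ₗ[R] A →ₗ[R] B
  alt : ∀ a, toBilin a a = 0

namespace HyperplaneDistribution

variable (H : HyperplaneDistribution E M)

/-- Atiyah two-forms `Ω²_D`. -/
abbrev AtiyahTwoForm := AlternatingTwoForm C^∞⟮𝓘(ℝ, E), M; ℝ⟯ H.Der H.NormalSection

variable {H}

/-- The values `dΘ(D, D') = D(Θ(D')) - D'(Θ(D)) - Θ([D, D'])` of the differential. -/
def AtiyahOneForm.dAux (Θ : H.AtiyahOneForm) (D D' : H.Der) : H.NormalSection :=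
  D.apply (Θ D') - D'.apply (Θ D) - Θ (D.bracket D')

theorem AtiyahOneForm.dAux_swap (Θ : H.AtiyahOneForm) (D D' : H.Der) :
    AtiyahOneForm.dAux Θ D D' = -AtiyahOneForm.dAux Θ D' D := by
  simp only [AtiyahOneForm.dAux]
  rw [D.bracket_swap D', map_neg]
  abel

theorem AtiyahOneForm.dAux_add_right (Θ : H.AtiyahOneForm) (D D' D'' : H.Der) :
    AtiyahOneForm.dAux Θ D (D' + D'') = AtiyahOneForm.dAux Θ D D' + AtiyahOneForm.dAux Θ D D'' := by
  have hadd (a b : H.NormalSection) : D.apply (a + b) = D.apply a + D.apply b := map_add D.1.1 a b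
  have hadd' (a : H.NormalSection) : (D' + D'').apply a = D'.apply a + D''.apply a := rfl
  simp only [AtiyahOneForm.dAux]
  rw [D.bracket_add_right, map_add, map_add, hadd, hadd']
  abel

theorem AtiyahOneForm.dAux_smul_right (Θ : H.AtiyahOneForm) (f : C^∞⟮𝓘(ℝ, E), M; ℝ⟯) (D D' : H.Der) :
    AtiyahOneForm.dAux Θ D (f • D') = f • AtiyahOneForm.dAux Θ D D' := by
  have hs (a : H.NormalSection) : (f • D').apply a = f • D'.apply a := rfl
  simp only [AtiyahOneForm.dAux]
  rw [D.bracket_smul_right, map_add, map_smul, map_smul, map_smul, D.leibniz, hs, smul_sub,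
    smul_sub]
  abel

/-- The differential `d_D : Ω¹_D → Ω²_D`. -/
def AtiyahOneForm.d (Θ : H.AtiyahOneForm) : H.AtiyahTwoForm where
  toBilin := LinearMap.mk₂ C^∞⟮𝓘(ℝ, E), M; ℝ⟯ (AtiyahOneForm.dAux Θ)
    (fun D D' D'' ↦ by
      rw [AtiyahOneForm.dAux_swap, AtiyahOneForm.dAux_add_right, neg_add,
        ← AtiyahOneForm.dAux_swap, ← AtiyahOneForm.dAux_swap])
    (fun f D D' ↦ by
      rw [AtiyahOneForm.dAux_swap, AtiyahOneForm.dAux_smul_right, ← smul_neg,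
        ← AtiyahOneForm.dAux_swap])
    (fun D D' D'' ↦ AtiyahOneForm.dAux_add_right Θ D D' D'')
    (fun f D D' ↦ AtiyahOneForm.dAux_smul_right Θ f D D')
  alt D := by
    have h : D.bracket D = 0 :=
      Der.ext' (fun l ↦ sub_self (D.apply (D.apply l))) (VecField.bracket_self _)
    rw [LinearMap.mk₂_apply, AtiyahOneForm.dAux, h, map_zero, sub_self, sub_zero]

variable (H)

/-- The Atiyah one-form `Θ = θ_H ∘ σ`. -/
def contactAtiyahForm : H.AtiyahOneForm where
  toFun D := H.thetaSection D.symbol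
  map_add' D D' := map_add H.thetaSection D.symbol D'.symbol
  map_smul' f D := map_smul H.thetaSection f D.symbol

/-- The symplectic Atiyah form `ω = d_D Θ`. -/
def symplecticAtiyahForm : H.AtiyahTwoForm := AtiyahOneForm.d H.contactAtiyahForm

/-- `J : ∧² J¹L → L` represents the Jacobi bracket: `J(j¹λ, j¹μ) = {λ, μ}`. -/
def IsJacobiTensor (J : AlternatingTwoForm C^∞⟮𝓘(ℝ, E), M; ℝ⟯ H.AtiyahOneForm H.NormalSection) : Prop :=
  ∀ l m : H.NormalSection, J.toBilin (H.jet l) (H.jet m) = H.jacobiBracket l m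

instance : Nonempty (AlternatingTwoForm C^∞⟮𝓘(ℝ, E), M; ℝ⟯ H.AtiyahOneForm H.NormalSection) := ⟨⟨0, fun _ ↦ rfl⟩⟩

/-- The Jacobi tensor: the unique `J : ∧² J¹L → L` such that `J(j¹λ, j¹μ) = {λ, μ}`. -/
def jacobiTensor : AlternatingTwoForm C^∞⟮𝓘(ℝ, E), M; ℝ⟯ H.AtiyahOneForm H.NormalSection :=
  Classical.epsilon H.IsJacobiTensor

/-- The dual bundle `L*` (its fibre at `x`). -/
abbrev Dual (x : M) : Type _ := H.Normal x →L[ℝ] Bundle.Trivial M ℝ x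

theorem isOpen_cone : IsOpen {ε : TotalSpace (ℝ →L[ℝ] ℝ) H.Dual | ε.2 ≠ 0} := by
  rw [isOpen_iff_mem_nhds]
  intro ε₀ hε₀
  set e := trivializationAt (ℝ →L[ℝ] ℝ) H.Dual ε₀.1 with he
  have hb : ε₀.1 ∈ e.baseSet := mem_baseSet_trivializationAt (ℝ →L[ℝ] ℝ) H.Dual ε₀.1
  have hsrc : ε₀ ∈ e.source := e.mem_source.2 hb
  have h0 : (e ε₀).2 ≠ 0 := by
    intro h
    apply hε₀
    apply (e.linearEquivAt ℝ ε₀.1 hb).injective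
    rw [map_zero]
    exact h
  have hc : ContinuousAt (fun ε ↦ (e ε).2) ε₀ :=
    continuous_snd.continuousAt.comp (e.continuousAt hsrc)
  filter_upwards [hc.eventually_ne h0, e.open_source.mem_nhds hsrc] with ε h1 h2 h3
  apply h1
  have hb' : ε.1 ∈ e.baseSet := e.mem_source.1 h2
  have h4 := map_zero (e.linearEquivAt ℝ ε.1 hb')
  rw [← h3] at h4
  exact h4

/-- `L* ∖ 0`, an open subset of the total space of `L*`. -/
def coneOpens : TopologicalSpace.Opens (TotalSpace (ℝ →L[ℝ] ℝ) H.Dual) :=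
  ⟨{ε | ε.2 ≠ 0}, H.isOpen_cone⟩

/-- The manifold `L̃ = L* ∖ 0`. -/
abbrev Cone : Type _ := H.coneOpens

/-- The function `λ̃(ε) = ⟨ε, λ⟩` on `L̃`. -/
def lift (l : H.NormalSection) : C^∞⟮𝓘(ℝ, E).prod 𝓘(ℝ, ℝ →L[ℝ] ℝ), H.Cone; ℝ⟯ :=
  ⟨fun ε ↦ ε.1.2 (l ε.1.1), by
    have h1 : ContMDiff (𝓘(ℝ, E).prod 𝓘(ℝ, ℝ →L[ℝ] ℝ)) (𝓘(ℝ, E).prod 𝓘(ℝ, ℝ →L[ℝ] ℝ)) ∞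
        (fun ε : H.Cone ↦ (⟨ε.1.1, ε.1.2⟩ : TotalSpace (ℝ →L[ℝ] ℝ) H.Dual)) :=
      contMDiff_subtype_val
    have h2 : ContMDiff (𝓘(ℝ, E).prod 𝓘(ℝ, ℝ →L[ℝ] ℝ)) 𝓘(ℝ, E) ∞ (fun ε : H.Cone ↦ ε.1.1) :=
      (contMDiff_proj H.Dual).comp contMDiff_subtype_val
    have h3 : ContMDiff (𝓘(ℝ, E).prod 𝓘(ℝ, ℝ →L[ℝ] ℝ)) (𝓘(ℝ, E).prod 𝓘(ℝ, ℝ)) ∞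
        (fun ε : H.Cone ↦ (⟨ε.1.1, l ε.1.1⟩ : TotalSpace ℝ H.Normal)) := l.contMDiff.comp h2
    have h4 := ContMDiff.clm_bundle_apply h1 h3
    intro ε
    have h5 := h4 ε
    rw [contMDiffAt_totalSpace] at h5
    exact h5.2⟩

/-- Smooth vector fields on `L̃`. -/
abbrev ConeVecField := VecField (𝓘(ℝ, E).prod 𝓘(ℝ, ℝ →L[ℝ] ℝ)) H.Cone

instance : Nonempty H.ConeVecField := ⟨0⟩

/-- The lift `D̃` of a derivation `D`: the unique vector field on `L̃` such that
`D̃(λ̃) = (D(λ))~` for all `λ`. -/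
def liftDer (D : H.Der) : H.ConeVecField :=
  Classical.epsilon fun V ↦ ∀ l : H.NormalSection, V.deriv (H.lift l) = H.lift (D.apply l)

/-- The lift `ψ̃` of an Atiyah one-form: the unique one-form on `L̃` such that
`ψ̃(D̃) = (ψ(D))~` for all derivations `D`. -/
def liftOneForm (ψ : H.AtiyahOneForm) : DiffOneForm (𝓘(ℝ, E).prod 𝓘(ℝ, ℝ →L[ℝ] ℝ)) H.Cone :=
  Classical.epsilon fun α ↦ ∀ (D : H.Der) (ε : H.Cone),
    α.toFun ε (H.liftDer D ε) = H.lift (ψ D) ε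

/-- The lift `η̃` of an Atiyah two-form: the unique two-form on `L̃` such that
`η̃(D̃, D̃') = (η(D, D'))~` for all derivations `D, D'`. -/
def liftTwoForm (η : H.AtiyahTwoForm) : DiffTwoForm (𝓘(ℝ, E).prod 𝓘(ℝ, ℝ →L[ℝ] ℝ)) H.Cone :=
  Classical.epsilon fun α ↦ ∀ (D D' : H.Der) (ε : H.Cone),
    α.toFun ε (H.liftDer D ε) (H.liftDer D' ε) = H.lift (η.toBilin D D') ε

/-- The symplectic form `ω̃` of the symplectization `(L̃, ω̃)`. -/
def symplecticForm : DiffTwoForm (𝓘(ℝ, E).prod 𝓘(ℝ, ℝ →L[ℝ] ℝ)) H.Cone :=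
  H.liftTwoForm H.symplecticAtiyahForm

end HyperplaneDistribution

end Contact

end ContactGeom

end

noncomputable section

namespace ContactGeom

open Bundle Set Filter Topology

set_option linter.unusedSectionVars false

/-! ### Local coordinates given by globally defined functions -/

section Coordinates

variable {E : Type*} [NormedAddCommGroup E] [NormedSpace ℝ E]
  {B : Type*} [TopologicalSpace B] {I : ModelWithCorners ℝ E B}
  {N : Type*} [TopologicalSpace N] [ChartedSpace B N] [IsManifold I ∞ N]
  {ι : Type*} [Fintype ι] [DecidableEq ι]

/-! Both brackets are the inverse of one and the same form, computed before and after lifting to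
`L̃`. The contact condition makes the Atiyah form `ω` non-degenerate (`IsContact.vanishesAt`), so `D
↦ ω(D, -)` is an isomorphism from derivations to Atiyah one-forms (`IsContact.flat`). Write `D_ψ`
for the preimage of `ψ`.

Downstairs, suppose `ω(D, -) = -j¹μ`. Evaluating at the identity derivation gives `θ(σ(D)) = μ`, and
evaluating at an arbitrary `D'` then gives `D(θ(σ(D'))) = θ([σ(D), σ(D')])`. Hence `σ(D)` is a
contact vector field, it is `X_μ`, and `{λ, μ} = D_{j¹μ}(λ)` (`IsContact.jacobiBracket_eq`). So `(ψ,
χ) ↦ ψ(D_χ) = ω(D_ψ, D_χ)` represents the Jacobi bracket. It is the Jacobi tensor because jets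
generate the Atiyah one-forms locally (`IsJacobiTensor.unique`).

Upstairs, the lifts of derivations exhaust every tangent space of `L̃` (`exists_liftDer_eq`).
Testing on them gives `ω̃(D̃_ψ, -) = ψ̃`, so `J̃(ψ̃, χ̃) = ψ̃(D̃_χ)` is the lift of `ψ(D_χ)`
(`IsContact.poissonTensor_lift`). This is the second identity. The first is the case of jets, since
the lift of `j¹λ` is `dλ̃` (`liftOneForm_jet`).

The Hamiltonian fields, the Jacobi tensor and all the lifts are defined by `Classical.epsilon`, so
each defining property must be earned by an existence proof. These are local computations in frames,
glued by pointwise uniqueness. Derivations are operators on global sections, so the frames are cut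
off by bump functions and localisation is done through the Leibniz rule. -/

theorem mvfderiv_congr {f g : N → ℝ} {p : N} (h : f =ᶠ[𝓝 p] g) :
    mvfderiv I f p = mvfderiv I g p :=
  h.mfderiv_eq

theorem mdifferentiableAt_smooth (f : C^∞⟮I, N; ℝ⟯) (p : N) : MDifferentiableAt I 𝓘(ℝ, ℝ) f p :=
  f.contMDiff.mdifferentiableAt (by simp)

theorem mvfderiv_smooth_mul (f g : C^∞⟮I, N; ℝ⟯) (p : N) (v : TangentSpace I p) :
    mvfderiv I (f * g : C^∞⟮I, N; ℝ⟯) p v = mvfderiv I f p v * g p + f p * mvfderiv I g p v := by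
  have h := mvfderiv_mul (mdifferentiableAt_smooth (I := I) f p) (mdifferentiableAt_smooth g p)
  have h' := congrArg (fun L ↦ L v) h
  refine h'.trans ?_
  simp [mul_comm, add_comm]

/-- A finite family of smooth functions, as a map to a coordinate space. -/
def coordMap (u : ι → C^∞⟮I, N; ℝ⟯) (q : N) : ι → ℝ := fun i ↦ u i q

theorem contMDiff_coordMap (u : ι → C^∞⟮I, N; ℝ⟯) :
    ContMDiff I 𝓘(ℝ, ι → ℝ) ∞ (coordMap u) :=
  contMDiff_pi_space.2 fun i ↦ (u i).contMDiff

theorem mfderiv_coordMap_apply (u : ι → C^∞⟮I, N; ℝ⟯) (q : N) (v : TangentSpace I q) (i : ι) :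
    (mfderiv I 𝓘(ℝ, ι → ℝ) (coordMap u) q v : ι → ℝ) i = mvfderiv I (u i) q v := by
  have hp : MDifferentiableAt 𝓘(ℝ, ι → ℝ) 𝓘(ℝ, ℝ)
      (ContinuousLinearMap.proj (R := ℝ) (φ := fun _ : ι ↦ ℝ) i) (coordMap u q) :=
    (ContinuousLinearMap.proj (R := ℝ) (φ := fun _ : ι ↦ ℝ) i).mdifferentiableAt
  have h := mvfderiv_comp_apply (I := 𝓘(ℝ, ι → ℝ)) (I' := I) q hp
    ((contMDiff_coordMap u).mdifferentiableAt (by simp)) v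
  refine Eq.trans ?_ h.symm
  have h2 : mvfderiv 𝓘(ℝ, ι → ℝ) (ContinuousLinearMap.proj (R := ℝ) (φ := fun _ : ι ↦ ℝ) i)
      (coordMap u q) = ContinuousLinearMap.proj (R := ℝ) (φ := fun _ : ι ↦ ℝ) i :=
    ContinuousLinearMap.mfderiv_eq _
  exact (congrArg (fun L : (ι → ℝ) →L[ℝ] ℝ ↦ L (mfderiv I 𝓘(ℝ, ι → ℝ) (coordMap u) q v)) h2).symm

/-- The functions `u i` are local coordinates at `q`. -/
def IsCoordAt (u : ι → C^∞⟮I, N; ℝ⟯) (q : N) : Prop :=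
  (mfderiv I 𝓘(ℝ, ι → ℝ) (coordMap u) q).IsInvertible

theorem eventually_isCoordAt {u : ι → C^∞⟮I, N; ℝ⟯} {p : N} (A : E ≃L[ℝ] (ι → ℝ))
    (hA : coordMap u =ᶠ[𝓝 p] A ∘ extChartAt I p) : ∀ᶠ q in 𝓝 p, IsCoordAt u q := by
  have : IsManifold I 1 N := IsManifold.of_le (n := ∞) (by simp)
  -- The differential at `q` needs the two maps to agree near `q`, not only at `q`.
  filter_upwards [hA.eventually_nhds, extChartAt_source_mem_nhds (I := I) p] with q hq hs
  rw [IsCoordAt, Filter.EventuallyEq.mfderiv_eq hq]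
  have h1 := isInvertible_mfderiv_extChartAt hs
  have h2 : MDifferentiableAt I 𝓘(ℝ, E) (extChartAt I p) q :=
    mdifferentiableAt_extChartAt (by simpa using hs)
  have h3 := mfderiv_comp (I := I) (I' := 𝓘(ℝ, E)) (I'' := 𝓘(ℝ, ι → ℝ)) q
    (A : E →L[ℝ] (ι → ℝ)).mdifferentiableAt h2
  have h4 : (mfderiv I 𝓘(ℝ, ι → ℝ) (A ∘ extChartAt I p) q) =
    (A : E →L[ℝ] (ι → ℝ)).comp (mfderiv I 𝓘(ℝ, E) (extChartAt I p) q) := by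
    refine h3.trans ?_
    rw [ContinuousLinearMap.mfderiv_eq]
    rfl
  rw [h4]
  exact (ContinuousLinearMap.isInvertible_equiv (f := A)).comp h1

/-- The coordinate vector fields of a family of functions which are local coordinates. -/
def dualField (u : ι → C^∞⟮I, N; ℝ⟯) (i : ι) (q : N) : TangentSpace I q :=
  VectorField.mpullback I 𝓘(ℝ, ι → ℝ) (coordMap u) (fun _ ↦ (Pi.single i 1 : ι → ℝ)) q

theorem contMDiffAt_dualField [CompleteSpace E] {u : ι → C^∞⟮I, N; ℝ⟯} {q : N}
    (h : IsCoordAt u q) (i : ι) :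
    ContMDiffAt I I.tangent ∞ (fun y ↦ (TotalSpace.mk y (dualField u i y) : TangentBundle I N)) q := by
  have : IsManifold I 1 N := IsManifold.of_le (n := ∞) (by simp)
  have : IsManifold I (((⊤ : ℕ∞) : ℕ∞ω) + 1) N := inferInstanceAs (IsManifold I ∞ N)
  refine ContMDiffAt.mpullback_vectorField_preimage (n := ∞) ?_
    (contMDiff_coordMap u q) h (by simp)
  exact contMDiffAt_vectorSpace_iff_contDiffAt.2 contDiffAt_const

/-- The pullback applies the inverse of the differential of `coordMap u` to a standard basis vector,
so the `dualField u i` are dual to the differentials `d(u j)`. -/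
theorem mvfderiv_dualField {u : ι → C^∞⟮I, N; ℝ⟯} {q : N}
    (h : IsCoordAt u q) (i j : ι) :
    mvfderiv I (u j) q (dualField u i q) = (Pi.single i 1 : ι → ℝ) j := by
  rw [← mfderiv_coordMap_apply]
  exact congrFun (h.self_apply_inverse (Pi.single i 1 : ι → ℝ)) j

theorem ext_of_isCoordAt {u : ι → C^∞⟮I, N; ℝ⟯} {q : N} (h : IsCoordAt u q)
    {v w : TangentSpace I q} (hvw : ∀ i, mvfderiv I (u i) q v = mvfderiv I (u i) q w) : v = w := by
  obtain ⟨e, he⟩ := h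
  apply e.injective
  have he' (v : TangentSpace I q) : e v = mfderiv I 𝓘(ℝ, ι → ℝ) (coordMap u) q v :=
    congrArg (fun L ↦ L v) he
  rw [he', he']
  funext i
  exact (mfderiv_coordMap_apply u q v i).trans
    ((hvw i).trans (mfderiv_coordMap_apply u q w i).symm)

theorem mvfderiv_sum_dualField {u : ι → C^∞⟮I, N; ℝ⟯} {q : N} (h : IsCoordAt u q) (c : ι → ℝ)
    (j : ι) : mvfderiv I (u j) q (∑ i, c i • dualField u i q) = c j := by
  rw [map_sum]
  simp [mvfderiv_dualField h, Pi.single_apply]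

theorem eq_sum_dualField {u : ι → C^∞⟮I, N; ℝ⟯} {q : N} (h : IsCoordAt u q)
    (v : TangentSpace I q) : v = ∑ i, mvfderiv I (u i) q v • dualField u i q := by
  exact ext_of_isCoordAt h fun j ↦ (mvfderiv_sum_dualField h (fun i ↦ mvfderiv I (u i) q v) j).symm

end Coordinates

/-! ### Bump functions and cut-off sections -/

section Extension

variable {E : Type*} [NormedAddCommGroup E] [NormedSpace ℝ E] [FiniteDimensional ℝ E]
  {M : Type*} [TopologicalSpace M] [T2Space M] [ChartedSpace E M] [IsManifold 𝓘(ℝ, E) ∞ M]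

/-- Control of the closed support, not just of the support, is what makes the product with an object
smooth only on `U` globally smooth. -/
theorem exists_bump {U : Set M} {x₀ : M} (hU : U ∈ 𝓝 x₀) :
    ∃ k : C^∞⟮𝓘(ℝ, E), M; ℝ⟯, (∀ᶠ x in 𝓝 x₀, k x = 1) ∧ tsupport k ⊆ U := by
  obtain ⟨f, hf, -⟩ := (SmoothBumpFunction.nhds_basis_support (I := 𝓘(ℝ, E)) hU).mem_iff.1 hU
  exact ⟨⟨f, f.contMDiff⟩, f.eventuallyEq_one, hf⟩

theorem exists_extension {U : Set M} {x₀ : M} (hU : U ∈ 𝓝 x₀) (g : M → ℝ)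
    (hg : ∀ x ∈ U, ContMDiffAt 𝓘(ℝ, E) 𝓘(ℝ, ℝ) ∞ g x) :
    ∃ G : C^∞⟮𝓘(ℝ, E), M; ℝ⟯, ∀ᶠ x in 𝓝 x₀, G x = g x := by
  obtain ⟨k, hk, hs⟩ := exists_bump (E := E) hU
  refine ⟨⟨fun x ↦ k x • g x, contMDiff_of_tsupport fun x hx ↦ ?_⟩, ?_⟩
  · exact (k.contMDiff x).smul (hg x (hs (tsupport_smul_subset_left _ _ hx)))
  · filter_upwards [hk] with x hx
    change k x • g x = g x
    rw [hx, one_smul]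

variable {F : Type*} [NormedAddCommGroup F] [NormedSpace ℝ F]
  {V : M → Type*} [TopologicalSpace (TotalSpace F V)] [∀ x, AddCommGroup (V x)]
  [∀ x, Module ℝ (V x)] [∀ x, TopologicalSpace (V x)] [FiberBundle F V] [VectorBundle ℝ F V]

theorem exists_bump_smul_section {U : Set M} (hU : IsOpen U)
    (s : ∀ x, V x) (hs : ContMDiffOn 𝓘(ℝ, E) (𝓘(ℝ, E).prod 𝓘(ℝ, F)) ∞
      (fun x ↦ (TotalSpace.mk x (s x) : TotalSpace F V)) U) {k : C^∞⟮𝓘(ℝ, E), M; ℝ⟯}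
    (hk : tsupport k ⊆ U) :
    ∃ S : Cₛ^∞⟮𝓘(ℝ, E); F, V⟯, ∀ x, S x = k x • s x :=
  ⟨⟨fun x ↦ k x • s x, ContMDiffOn.smul_section_of_tsupport k.contMDiff.contMDiffOn hU hk hs⟩,
    fun _ ↦ rfl⟩

end Extension

/-! ### Pointwise rules for sections and derivatives -/

section Derivatives

variable {E : Type*} [NormedAddCommGroup E] [NormedSpace ℝ E]
  {B : Type*} [TopologicalSpace B] {I : ModelWithCorners ℝ E B}
  {N : Type*} [TopologicalSpace N] [ChartedSpace B N] [IsManifold I ∞ N]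
  {F : Type*} [NormedAddCommGroup F] [NormedSpace ℝ F]
  {V : N → Type*} [TopologicalSpace (TotalSpace F V)] [∀ x, AddCommGroup (V x)]
  [∀ x, Module ℝ (V x)] [∀ x, TopologicalSpace (V x)] [FiberBundle F V] [VectorBundle ℝ F V]

theorem section_sum_apply {κ : Type*} (t : Finset κ) (s : κ → Cₛ^∞⟮I; F, V⟯) (x : N) :
    (∑ i ∈ t, s i) x = ∑ i ∈ t, s i x := by
  have := map_sum (ContMDiffSection.coeAddHom I F ∞ V) s t
  rw [← Finset.sum_apply]
  exact congrFun this x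

theorem function_sum_apply {κ : Type*} (t : Finset κ) (f : κ → C^∞⟮I, N; ℝ⟯) (x : N) :
    (∑ i ∈ t, f i) x = ∑ i ∈ t, f i x :=
  map_sum (ContMDiffMap.evalRingHom (n := ∞) (I := I) x) f t

theorem section_add_apply (s t : Cₛ^∞⟮I; F, V⟯) (x : N) : (s + t) x = s x + t x := rfl

theorem section_sub_apply (s t : Cₛ^∞⟮I; F, V⟯) (x : N) : (s - t) x = s x - t x := rfl

theorem section_neg_apply (s : Cₛ^∞⟮I; F, V⟯) (x : N) : (-s) x = -s x := rfl

theorem section_zero_apply (x : N) : (0 : Cₛ^∞⟮I; F, V⟯) x = 0 := rfl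

theorem function_mul_apply (f g : C^∞⟮I, N; ℝ⟯) (x : N) : (f * g) x = f x * g x := rfl

theorem VecField.deriv_mul (X : VecField I N) (f g : C^∞⟮I, N; ℝ⟯) :
    X.deriv (f * g) = X.deriv f * g + f * X.deriv g := by
  ext p
  exact mvfderiv_smooth_mul f g p (X p)

theorem VecField.deriv_add (X : VecField I N) (f g : C^∞⟮I, N; ℝ⟯) :
    X.deriv (f + g) = X.deriv f + X.deriv g := by
  ext p
  have h := mvfderiv_add (mdifferentiableAt_smooth (I := I) f p) (mdifferentiableAt_smooth g p)
  exact congrArg (fun L ↦ L (X p)) h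

theorem VecField.deriv_algebraMap (X : VecField I N) (c : ℝ) :
    X.deriv (algebraMap ℝ C^∞⟮I, N; ℝ⟯ c) = 0 := by
  ext p
  have h : mvfderiv I (fun _ : N ↦ c) p = 0 := mvfderiv_const c
  exact congrArg (fun L ↦ L (X p)) h

theorem VecField.smul_deriv (X : VecField I N) (f g : C^∞⟮I, N; ℝ⟯) :
    (f • X).deriv g = f * X.deriv g := by
  ext p
  exact map_smul (mvfderiv I g p) (f p) (X p)

/-- The derivative of a fixed function, as a linear map on vector fields. -/
def VecField.derivHom (f : C^∞⟮I, N; ℝ⟯) : VecField I N →ₗ[C^∞⟮I, N; ℝ⟯] C^∞⟮I, N; ℝ⟯ where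
  toFun X := X.deriv f
  map_add' X Y := by
    ext p
    exact map_add (mvfderiv I f p) (X p) (Y p)
  map_smul' g X := X.smul_deriv g f

/-- Used for cutoffs: where a cutoff is locally constant, it contributes nothing to the Leibniz
rule. -/
theorem VecField.deriv_eq_zero {X : VecField I N} {f : C^∞⟮I, N; ℝ⟯} {c : ℝ} {x : N}
    (h : ∀ᶠ y in 𝓝 x, f y = c) : X.deriv f x = 0 := by
  have h1 : mvfderiv I f x = 0 :=
    (mvfderiv_congr (g := fun _ ↦ c) h).trans (mvfderiv_const c)
  rw [VecField.deriv_apply, h1]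
  rfl

end Derivatives

/-! ### Adapted frames: a generator of `L`, coordinates and coordinate fields -/

section Contact

variable {E : Type*} [NormedAddCommGroup E] [NormedSpace ℝ E] [FiniteDimensional ℝ E]
  {M : Type*} [TopologicalSpace M] [ChartedSpace E M] [IsManifold 𝓘(ℝ, E) ∞ M]

namespace HyperplaneDistribution

variable (H : HyperplaneDistribution E M)

/-- A smooth frame of `L` and smooth coordinates near `x₀`, all cut off to be globally defined. -/
structure AdaptedFrame (x₀ : M) where
  cutoff : C^∞⟮𝓘(ℝ, E), M; ℝ⟯
  coeff : H.NormalSection →ₗ[C^∞⟮𝓘(ℝ, E), M; ℝ⟯] C^∞⟮𝓘(ℝ, E), M; ℝ⟯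
  gen : H.NormalSection
  cutoff_smul : ∀ l : H.NormalSection, cutoff • l = coeff l • gen
  cutoff_eq_one : ∀ᶠ x in 𝓝 x₀, cutoff x = 1
  gen_ne_zero : ∀ᶠ x in 𝓝 x₀, gen x ≠ 0
  gen_eq : ∀ᶠ x in 𝓝 x₀, gen x = (trivializationAt ℝ H.Normal x₀).symm x 1
  coord : Fin (Module.finrank ℝ E) → C^∞⟮𝓘(ℝ, E), M; ℝ⟯
  coord_eq : coordMap coord =ᶠ[𝓝 x₀] (Module.finBasis ℝ E).equivFunL ∘ extChartAt 𝓘(ℝ, E) x₀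
  field : Fin (Module.finrank ℝ E) → VecField 𝓘(ℝ, E) M
  field_eq : ∀ᶠ x in 𝓝 x₀, ∀ i, field i x = dualField coord i x

/-- The relation `h • l = b l • t` holds on all of `M`, not just near `x₀`, so operators on global
sections can be applied to both sides. -/
theorem exists_cutoff_frame [T2Space M] (x₀ : M) :
    ∃ (h : C^∞⟮𝓘(ℝ, E), M; ℝ⟯)
      (b : H.NormalSection →ₗ[C^∞⟮𝓘(ℝ, E), M; ℝ⟯] C^∞⟮𝓘(ℝ, E), M; ℝ⟯) (t : H.NormalSection),
      (∀ l : H.NormalSection, h • l = b l • t) ∧ (∀ᶠ x in 𝓝 x₀, h x = 1) ∧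
      (∀ᶠ x in 𝓝 x₀, t x ≠ 0) ∧
      (∀ᶠ x in 𝓝 x₀, t x = (trivializationAt ℝ H.Normal x₀).symm x 1) := by
  set e := trivializationAt ℝ H.Normal x₀ with he
  have hx₀ : e.baseSet ∈ 𝓝 x₀ :=
    e.open_baseSet.mem_nhds (mem_baseSet_trivializationAt ℝ H.Normal x₀)
  obtain ⟨k, hk1, hk⟩ := exists_bump (E := E) hx₀
  have hzero {x : M} (hx : x ∉ e.baseSet) : k x = 0 :=
    image_eq_zero_of_notMem_tsupport fun h ↦ hx (hk h)
  have hsm (l : H.NormalSection) : ContMDiffOn 𝓘(ℝ, E) 𝓘(ℝ, ℝ) ∞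
      (fun x ↦ e.linearMapAt ℝ x (l x)) e.baseSet := by
    have h1 := (e.contMDiffOn_section_baseSet_iff (IB := 𝓘(ℝ, E)) (n := ∞)).1
      l.contMDiff.contMDiffOn
    refine h1.congr fun x hx ↦ ?_
    rw [e.coe_linearMapAt_of_mem hx]
  have hgen : ContMDiffOn 𝓘(ℝ, E) (𝓘(ℝ, E).prod 𝓘(ℝ, ℝ)) ∞
      (fun x ↦ (TotalSpace.mk x (e.symm x 1) : TotalSpace ℝ H.Normal)) e.baseSet := by
    refine (e.contMDiffOn_section_baseSet_iff (IB := 𝓘(ℝ, E)) (n := ∞)).2 ?_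
    refine (contMDiffOn_const (c := (1 : ℝ))).congr fun x hx ↦ ?_
    exact congrArg Prod.snd (e.apply_mk_symm hx 1)
  obtain ⟨t, ht⟩ := exists_bump_smul_section e.open_baseSet _ hgen hk
  -- The coefficient map and the generator each need one factor `k` to be globally smooth, so the
  -- cutoff in the relation is `k²`.
  refine ⟨k * k, ⟨⟨fun l ↦ ⟨fun x ↦ k x • e.linearMapAt ℝ x (l x),
    contMDiff_of_tsupport fun x hx ↦ ?_⟩, ?_⟩, ?_⟩, t, ?_, ?_, ?_, ?_⟩
  · exact (k.contMDiff x).smul ((hsm l).contMDiffAt (e.open_baseSet.mem_nhds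
      (hk (tsupport_smul_subset_left _ _ hx))))
  · intro l m
    ext x
    change k x • e.linearMapAt ℝ x (l x + m x) =
      k x • e.linearMapAt ℝ x (l x) + k x • e.linearMapAt ℝ x (m x)
    rw [map_add, smul_add]
  · intro f l
    ext x
    change k x • e.linearMapAt ℝ x (f x • l x) = f x * (k x • e.linearMapAt ℝ x (l x))
    rw [map_smul, smul_comm]
    rfl
  · intro l
    ext x
    change (k x * k x) • l x = (k x • e.linearMapAt ℝ x (l x)) • t x
    rw [ht]
    by_cases hx : x ∈ e.baseSet
    · have h1 : e.linearMapAt ℝ x (l x) • e.symm x 1 = l x := by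
        rw [← e.symmₗ_apply (R := ℝ) hx, ← map_smul, smul_eq_mul, mul_one,
          e.symmₗ_linearMapAt hx]
      conv_lhs => rw [← h1, smul_smul]
      rw [smul_smul, smul_eq_mul, mul_right_comm]
    · simp [hzero hx]
  · filter_upwards [hk1] with x hx
    rw [function_mul_apply, hx, one_mul]
  · filter_upwards [hk1, hx₀] with x hx hx' h0
    rw [ht, hx, one_smul] at h0
    have h1 := e.linearMapAt_symm (R := ℝ) hx' 1
    rw [h0, map_zero] at h1
    exact zero_ne_one h1
  · filter_upwards [hk1] with x hx
    rw [ht, hx, one_smul]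

theorem exists_adaptedFrame [T2Space M] (x₀ : M) : Nonempty (H.AdaptedFrame x₀) := by
  obtain ⟨h, b, t, h1, h2, h3, h4⟩ := H.exists_cutoff_frame x₀
  set A := (Module.finBasis ℝ E).equivFunL
  have hsm (i : Fin (Module.finrank ℝ E)) : ∀ x ∈ (chartAt E x₀).source,
      ContMDiffAt 𝓘(ℝ, E) 𝓘(ℝ, ℝ) ∞ (fun x ↦ A (extChartAt 𝓘(ℝ, E) x₀ x) i) x := by
    intro x hx
    have h5 : ContMDiffAt 𝓘(ℝ, E) 𝓘(ℝ, E) ∞ (extChartAt 𝓘(ℝ, E) x₀) x :=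
      contMDiffAt_extChartAt' hx
    exact contMDiffAt_pi_space.1 ((A : E →L[ℝ] (Fin (Module.finrank ℝ E) → ℝ)).contMDiff.contMDiffAt.comp x h5) i
  choose u hu using fun i ↦ exists_extension ((chartAt E x₀).open_source.mem_nhds
    (mem_chart_source E x₀)) _ (hsm i)
  have hu' : coordMap u =ᶠ[𝓝 x₀] A ∘ extChartAt 𝓘(ℝ, E) x₀ := by
    filter_upwards [eventually_all.2 hu] with x hx
    exact funext hx
  -- The extended coordinate functions are coordinates only near `x₀`. A second bump function,
  -- supported where they are, cuts off their dual fields.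
  obtain ⟨U, hU, hUo, hxU⟩ := eventually_nhds_iff.1 (eventually_isCoordAt A hu')
  obtain ⟨k, hk1, hk⟩ := exists_bump (E := E) (hUo.mem_nhds hxU)
  choose X hX using fun i ↦ exists_bump_smul_section hUo (dualField u i)
    (fun x hx ↦ (contMDiffAt_dualField (hU x hx) i).contMDiffWithinAt) hk
  refine ⟨⟨h, b, t, h1, h2, h3, h4, u, hu', X, ?_⟩⟩
  filter_upwards [hk1] with x hx i
  rw [hX, hx, one_smul]

end HyperplaneDistribution

end Contact

/-! ### Local frames of derivations and tensoriality of Atiyah forms -/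

section Contact

variable {E : Type*} [NormedAddCommGroup E] [NormedSpace ℝ E] [FiniteDimensional ℝ E]
  {M : Type*} [TopologicalSpace M] [ChartedSpace E M] [IsManifold 𝓘(ℝ, E) ∞ M]

namespace HyperplaneDistribution

variable {H : HyperplaneDistribution E M}

theorem Der.apply_add (D : H.Der) (l m : H.NormalSection) :
    D.apply (l + m) = D.apply l + D.apply m := map_add D.1.1 l m

theorem Der.apply_zero (D : H.Der) : D.apply 0 = 0 := map_zero D.1.1

theorem Der.sub_apply (D D' : H.Der) (l : H.NormalSection) :
    (D - D').apply l = D.apply l - D'.apply l := rfl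

theorem Der.smul_apply (f : C^∞⟮𝓘(ℝ, E), M; ℝ⟯) (D : H.Der) (l : H.NormalSection) :
    (f • D).apply l = f • D.apply l := rfl

variable (H) in
/-- The symbol as a linear map. -/
def symbolHom : H.Der →ₗ[C^∞⟮𝓘(ℝ, E), M; ℝ⟯] VecField 𝓘(ℝ, E) M where
  toFun D := D.symbol
  map_add' _ _ := rfl
  map_smul' _ _ := rfl

variable (H) in
/-- The identity derivation, with vanishing symbol. -/
def euler : H.Der :=
  ⟨(LinearMap.id, 0), by
    intro f l
    ext x
    simp [smul_section_apply, VecField.deriv_apply]⟩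

theorem euler_apply (l : H.NormalSection) : H.euler.apply l = l := rfl

theorem euler_symbol : H.euler.symbol = 0 := rfl

theorem Der.leibniz_apply (D : H.Der) (f : C^∞⟮𝓘(ℝ, E), M; ℝ⟯) (l : H.NormalSection) (x : M) :
    D.apply (f • l) x = D.symbol.deriv f x • l x + f x • D.apply l x :=
  congrArg (fun s : H.NormalSection ↦ s x) (D.leibniz f l)

/-- The derivation `D` vanishes at the point `x`. -/
def Der.VanishesAt (D : H.Der) (x : M) : Prop := ∀ l, D.apply l x = 0

namespace AdaptedFrame

variable {x₀ : M} (F : H.AdaptedFrame x₀)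

theorem eventually_isCoordAt : ∀ᶠ x in 𝓝 x₀, IsCoordAt F.coord x :=
  ContactGeom.eventually_isCoordAt _ F.coord_eq

theorem smul_apply (l : H.NormalSection) (x : M) : F.cutoff x • l x = F.coeff l x • F.gen x :=
  congrArg (fun s : H.NormalSection ↦ s x) (F.cutoff_smul l)

theorem eventually_coeff_smul :
    ∀ᶠ x in 𝓝 x₀, ∀ l : H.NormalSection, F.coeff l x • F.gen x = l x := by
  filter_upwards [F.cutoff_eq_one] with x hx l
  rw [← F.smul_apply, hx, one_smul]

theorem eventually_coeff_gen : ∀ᶠ x in 𝓝 x₀, F.coeff F.gen x = 1 := by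
  filter_upwards [F.eventually_coeff_smul, F.gen_ne_zero] with x hx h0
  have h1 := hx F.gen
  rw [← sub_eq_zero]
  have h2 : (F.coeff F.gen x - 1) • F.gen x = 0 := by rw [sub_smul, h1, one_smul, sub_self]
  exact (smul_eq_zero.1 h2).resolve_right h0

/-- The derivation `λ ↦ X(λ₁) e` with respect to the frame `e` (up to the cutoff). -/
def conn (X : VecField 𝓘(ℝ, E) M) : H.Der :=
  ⟨({ toFun := fun l ↦ X.deriv (F.coeff l) • F.gen
      map_add' := fun l m ↦ by rw [map_add, VecField.deriv_add, add_smul]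
      map_smul' := fun c l ↦ by
        have h1 (m : H.NormalSection) : c • m = algebraMap ℝ C^∞⟮𝓘(ℝ, E), M; ℝ⟯ c • m := rfl
        rw [RingHom.id_apply, h1, h1, map_smul, smul_eq_mul, VecField.deriv_mul,
          VecField.deriv_algebraMap, zero_mul, zero_add, mul_smul] }, F.cutoff • X), by
    intro f l
    change X.deriv (F.coeff (f • l)) • F.gen =
      (F.cutoff • X).deriv f • l + f • X.deriv (F.coeff l) • F.gen
    -- The derivative of `f` appears multiplied by `F.coeff l • F.gen = F.cutoff • l`. This is why
    -- the symbol is `F.cutoff • X` and not `X`.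
    rw [map_smul, smul_eq_mul, VecField.deriv_mul, add_smul, mul_smul, mul_smul, ← F.cutoff_smul,
      VecField.smul_deriv, mul_comm, mul_smul, smul_comm]⟩

theorem conn_symbol (X : VecField 𝓘(ℝ, E) M) : (F.conn X).symbol = F.cutoff • X := rfl

/-- Locality of derivations: where the cutoff is locally `1`, `D l` agrees with `D (F.cutoff • l) =
D (F.coeff l • F.gen)`, to which the Leibniz rule applies. -/
theorem eventually_apply_eq : ∀ᶠ x in 𝓝 x₀, ∀ (D : H.Der) (l : H.NormalSection),
    D.apply l x = D.symbol.deriv (F.coeff l) x • F.gen x + F.coeff l x • D.apply F.gen x := by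
  filter_upwards [F.cutoff_eq_one.eventually_nhds] with x hx D l
  rw [← D.leibniz_apply, ← F.cutoff_smul, D.leibniz_apply, VecField.deriv_eq_zero hx,
    hx.self_of_nhds, zero_smul, zero_add, one_smul]

/-- The derivations of the frame. -/
def der : Option (Fin (Module.finrank ℝ E)) → H.Der
  | none => H.euler
  | some i => F.conn (F.field i)

/-- The coefficients with respect to the frame of derivations. -/
def comp : Option (Fin (Module.finrank ℝ E)) →
    H.Der →ₗ[C^∞⟮𝓘(ℝ, E), M; ℝ⟯] C^∞⟮𝓘(ℝ, E), M; ℝ⟯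
  | none => F.coeff ∘ₗ H.jet F.gen
  | some i => VecField.derivHom (F.coord i) ∘ₗ H.symbolHom

theorem eventually_deriv_eq_sum : ∀ᶠ x in 𝓝 x₀, ∀ (X : VecField 𝓘(ℝ, E) M)
    (f : C^∞⟮𝓘(ℝ, E), M; ℝ⟯),
    X.deriv f x = ∑ i, X.deriv (F.coord i) x * (F.field i).deriv f x := by
  filter_upwards [F.eventually_isCoordAt, F.field_eq] with x hx hf X f
  simp only [VecField.deriv_apply, hf]
  conv_lhs => rw [eq_sum_dualField hx (X x), map_sum]
  simp

theorem eventually_apply_eq_sum : ∀ᶠ x in 𝓝 x₀, ∀ (D : H.Der) (l : H.NormalSection),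
    D.apply l x = ∑ a, F.comp a D x • (F.der a).apply l x := by
  filter_upwards [F.eventually_apply_eq, F.eventually_coeff_smul,
    F.eventually_deriv_eq_sum] with x h1 h2 h3 D l
  rw [h1, h3, Fintype.sum_option, add_comm, Finset.sum_smul]
  congr 1
  · change F.coeff l x • D.apply F.gen x = F.coeff (D.apply F.gen) x • l x
    rw [← h2 (D.apply F.gen), ← h2 l, smul_smul, smul_smul, mul_comm]
  · refine Finset.sum_congr rfl fun i _ ↦ ?_
    exact mul_smul _ _ _

end AdaptedFrame

variable [T2Space M]

/-- Applied to `F.coord i • F.gen`, the Leibniz rule leaves only the derivative of the coordinate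
times the nonzero vector `F.gen x`. -/
theorem Der.VanishesAt.symbol {D : H.Der} {x : M} (h : D.VanishesAt x) : D.symbol x = 0 := by
  obtain ⟨F⟩ := H.exists_adaptedFrame x
  refine ext_of_isCoordAt F.eventually_isCoordAt.self_of_nhds fun i ↦ ?_
  have h1 := D.leibniz_apply (F.coord i) F.gen x
  rw [h, h, smul_zero, add_zero] at h1
  rw [map_zero]
  exact (smul_eq_zero.1 h1.symm).resolve_right F.gen_ne_zero.self_of_nhds

theorem Der.ext_apply {D D' : H.Der} (h : ∀ l, D.apply l = D'.apply l) : D = D' := by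
  refine Der.ext' h ?_
  ext x
  have h1 : (D - D').VanishesAt x := fun l ↦ by
    rw [Der.sub_apply, h, sub_self, section_zero_apply]
  exact sub_eq_zero.1 h1.symbol

theorem Der.sum_apply {κ : Type*} (t : Finset κ) (D : κ → H.Der) (l : H.NormalSection) :
    (∑ a ∈ t, D a).apply l = ∑ a ∈ t, (D a).apply l :=
  map_sum (H.jet l) D t

namespace AdaptedFrame

variable {x₀ : M} (F : H.AdaptedFrame x₀)

/-- A bump function `k` turns the local expansion of `D` into an identity of global derivations for
`k • D`, on which linearity of `ψ` over the smooth functions can be used. The neighbourhood does not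
depend on `ψ` or `D`. -/
theorem eventually_map_eq_sum : ∀ᶠ x in 𝓝 x₀, ∀ (ψ : H.AtiyahOneForm) (D : H.Der),
    ψ D x = ∑ a, F.comp a D x • ψ (F.der a) x := by
  obtain ⟨U, hU, hUo, hxU⟩ := eventually_nhds_iff.1 F.eventually_apply_eq_sum
  obtain ⟨k, hk1, hk⟩ := exists_bump (E := E) (hUo.mem_nhds hxU)
  filter_upwards [hk1] with x hx ψ D
  have h1 : k • D = ∑ a, (k * F.comp a D) • F.der a := by
    refine Der.ext_apply fun l ↦ ?_
    ext y
    rw [Der.sum_apply, section_sum_apply, Der.smul_apply, smul_section_apply]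
    simp only [Der.smul_apply, smul_section_apply, mul_smul]
    rw [← Finset.smul_sum]
    by_cases hy : y ∈ U
    · rw [hU y hy]
    · have : k y = 0 := image_eq_zero_of_notMem_tsupport fun h ↦ hy (hk h)
      rw [this, zero_smul, zero_smul]
  have h2 := congrArg (fun s : H.NormalSection ↦ s x) (congrArg ψ h1)
  simp only [map_smul, map_sum, smul_section_apply, section_sum_apply, function_mul_apply,
    hx, one_mul, one_smul] at h2
  exact h2

theorem comp_eq_zero {D : H.Der} (h : D.VanishesAt x₀) (a) : F.comp a D x₀ = 0 := by
  cases a with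
  | none =>
    have h1 := F.eventually_coeff_smul.self_of_nhds (D.apply F.gen)
    rw [h] at h1
    exact (smul_eq_zero.1 h1).resolve_right F.gen_ne_zero.self_of_nhds
  | some i =>
    change mvfderiv _ (F.coord i) x₀ (D.symbol x₀) = 0
    rw [h.symbol, map_zero]

theorem eventually_comp_der : ∀ᶠ x in 𝓝 x₀, ∀ a b,
    F.comp a (F.der b) x = if a = b then 1 else 0 := by
  filter_upwards [F.eventually_isCoordAt, F.field_eq, F.eventually_coeff_gen,
    F.eventually_coeff_gen.eventually_nhds, F.cutoff_eq_one] with x h1 h2 h3 h4 h5 a b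
  cases a with
  | none =>
    cases b with
    | none => exact h3.trans (by simp)
    | some j =>
      -- `F.coeff F.gen` is locally the constant `1`, so `F.conn` kills `F.gen` there.
      change F.coeff ((F.field j).deriv (F.coeff F.gen) • F.gen) x = _
      rw [map_smul, smul_eq_mul, function_mul_apply, VecField.deriv_eq_zero h4]
      simp
  | some i =>
    cases b with
    | none => exact map_zero (mvfderiv 𝓘(ℝ, E) (F.coord i) x)
    | some j =>
      change (F.cutoff • F.field j).deriv (F.coord i) x = _
      rw [VecField.smul_deriv, function_mul_apply, h5, one_mul, VecField.deriv_apply, h2,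
        mvfderiv_dualField h1, Pi.single_apply]
      simp

end AdaptedFrame

/-- Atiyah one-forms are tensorial. -/
theorem AtiyahOneForm.apply_eq_zero (ψ : H.AtiyahOneForm) {D : H.Der} {x : M}
    (h : D.VanishesAt x) : ψ D x = 0 := by
  obtain ⟨F⟩ := H.exists_adaptedFrame x
  rw [F.eventually_map_eq_sum.self_of_nhds]
  refine Finset.sum_eq_zero fun a _ ↦ ?_
  rw [F.comp_eq_zero h, zero_smul]

theorem AtiyahOneForm.apply_congr (ψ : H.AtiyahOneForm) {D D' : H.Der} {x : M}
    (h : ∀ l, D.apply l x = D'.apply l x) : ψ D x = ψ D' x := by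
  have h1 := ψ.apply_eq_zero (D := D - D') (x := x) fun l ↦ by
    rw [Der.sub_apply, section_sub_apply, h, sub_self]
  rw [map_sub] at h1
  exact sub_eq_zero.1 h1

theorem AtiyahTwoForm.swap (η : H.AtiyahTwoForm) (D D' : H.Der) :
    η.toBilin D D' = -η.toBilin D' D := by
  have h := η.alt (D + D')
  rw [map_add, map_add, LinearMap.add_apply, LinearMap.add_apply, η.alt, η.alt, zero_add,
    add_zero] at h
  exact eq_neg_of_add_eq_zero_left ((add_comm _ _).trans h)

/-- Atiyah two-forms are tensorial. -/
theorem AtiyahTwoForm.apply_congr (η : H.AtiyahTwoForm) {D₁ D₂ D₁' D₂' : H.Der} {x : M}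
    (h₁ : ∀ l, D₁.apply l x = D₁'.apply l x) (h₂ : ∀ l, D₂.apply l x = D₂'.apply l x) :
    η.toBilin D₁ D₂ x = η.toBilin D₁' D₂' x := by
  rw [AtiyahOneForm.apply_congr (η.toBilin D₁) h₂, AtiyahTwoForm.swap, section_neg_apply,
    AtiyahOneForm.apply_congr (η.toBilin D₂') h₁, ← section_neg_apply, ← AtiyahTwoForm.swap]

end HyperplaneDistribution

end Contact

/-! ### Locality of the Lie bracket of vector fields -/

section Brackets

variable {E : Type*} [NormedAddCommGroup E] [NormedSpace ℝ E] [CompleteSpace E]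
  {B : Type*} [TopologicalSpace B] {I : ModelWithCorners ℝ E B}
  {N : Type*} [TopologicalSpace N] [ChartedSpace B N] [IsManifold I ∞ N]

theorem VecField.bracket_zero_right (X : VecField I N) : X.bracket 0 = 0 := by
  have h := X.bracket_add_right 0 0
  rw [add_zero] at h
  exact left_eq_add.1 h

theorem VecField.bracket_zero_left (X : VecField I N) : VecField.bracket 0 X = 0 := by
  rw [VecField.bracket_swap, VecField.bracket_zero_right, neg_zero]

theorem VecField.bracket_sub_left (X Y Z : VecField I N) :
    (X - Y).bracket Z = X.bracket Z - Y.bracket Z := by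
  have h := Z.bracket_add_right (X - Y) Y
  rw [sub_add_cancel] at h
  rw [VecField.bracket_swap (X - Y), VecField.bracket_swap X, VecField.bracket_swap Y, h]
  abel

theorem VecField.bracket_cutoff_right (X Y : VecField I N) {h : C^∞⟮I, N; ℝ⟯} {x : N}
    (hx : ∀ᶠ y in 𝓝 x, h y = 1) : X.bracket (h • Y) x = X.bracket Y x := by
  rw [VecField.bracket_smul_right, section_add_apply, smul_section_apply, smul_section_apply,
    VecField.deriv_eq_zero hx, hx.self_of_nhds, zero_smul, zero_add, one_smul]

theorem VecField.bracket_cutoff_left (X Y : VecField I N) {h : C^∞⟮I, N; ℝ⟯} {x : N}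
    (hx : ∀ᶠ y in 𝓝 x, h y = 1) : (h • X).bracket Y x = X.bracket Y x := by
  rw [VecField.bracket_swap, section_neg_apply, VecField.bracket_cutoff_right _ _ hx,
    ← section_neg_apply, ← VecField.bracket_swap]

end Brackets

/-! ### Non-degeneracy and inversion of the Atiyah form `ω` -/

section Contact

variable {E : Type*} [NormedAddCommGroup E] [NormedSpace ℝ E] [FiniteDimensional ℝ E]
  {M : Type*} [TopologicalSpace M] [ChartedSpace E M] [IsManifold 𝓘(ℝ, E) ∞ M]

namespace HyperplaneDistribution

variable {H : HyperplaneDistribution E M}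

theorem theta_eq_zero {x : M} {v : TangentSpace 𝓘(ℝ, E) x} : H.theta x v = 0 ↔ v ∈ H.space x :=
  Submodule.Quotient.mk_eq_zero _

theorem thetaSection_apply (X : VecField 𝓘(ℝ, E) M) (x : M) :
    H.thetaSection X x = H.theta x (X x) := rfl

theorem thetaSection_eq_zero {X : VecField 𝓘(ℝ, E) M} :
    H.thetaSection X = 0 ↔ H.IsHorizontal X := by
  constructor
  · intro h x
    exact theta_eq_zero.1 (congrArg (fun s : H.NormalSection ↦ s x) h)
  · intro h
    ext x
    exact theta_eq_zero.2 (h x)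

theorem symplecticAtiyahForm_apply (D D' : H.Der) :
    H.symplecticAtiyahForm.toBilin D D' = D.apply (H.thetaSection D'.symbol) -
      D'.apply (H.thetaSection D.symbol) - H.thetaSection (D.symbol.bracket D'.symbol) := rfl

/-- The identity derivation has zero symbol and acts as the identity, so only one term of `dΘ`
survives: contracting `ω` with it gives back `Θ`. -/
theorem symplecticAtiyahForm_euler (D : H.Der) :
    H.symplecticAtiyahForm.toBilin H.euler D = H.thetaSection D.symbol := by
  rw [symplecticAtiyahForm_apply, euler_symbol, VecField.bracket_zero_left, map_zero,
    Der.apply_zero, sub_zero, sub_zero, euler_apply]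

/-- Gluing needs no partition of unity: at `x` the value of `D x` is used, and near `x₀` this is the
fixed derivation `D x₀`. The symbols agree as well, being determined by the derivations. -/
theorem Der.exists_glue [T2Space M] (D : M → H.Der)
    (h : ∀ x₀, ∀ᶠ x in 𝓝 x₀, ∀ l, (D x).apply l x = (D x₀).apply l x) :
    ∃ D' : H.Der, ∀ l x, D'.apply l x = (D x).apply l x := by
  have hs (x₀ : M) : ∀ᶠ x in 𝓝 x₀, (D x).symbol x = (D x₀).symbol x := by
    filter_upwards [h x₀] with x hx
    have h1 : (D x - D x₀).VanishesAt x := fun l ↦ by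
      rw [Der.sub_apply, section_sub_apply, hx, sub_self]
    exact sub_eq_zero.1 h1.symbol
  refine ⟨⟨(
    { toFun := fun l ↦ ⟨fun x ↦ (D x).apply l x, fun x₀ ↦ ?_⟩
      map_add' := fun l m ↦ ?_
      map_smul' := fun c l ↦ ?_ }, ⟨fun x ↦ (D x).symbol x, fun x₀ ↦ ?_⟩), ?_⟩, fun l x ↦ rfl⟩
  · refine (((D x₀).apply l).contMDiff x₀).congr_of_eventuallyEq ?_
    filter_upwards [h x₀] with x hx
    rw [hx l]
  · ext x
    change (D x).apply (l + m) x = (D x).apply l x + (D x).apply m x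
    rw [Der.apply_add, section_add_apply]
  · ext x
    have h1 : (D x).apply (c • l) = c • (D x).apply l := map_smul (D x).1.1 c l
    change (D x).apply (c • l) x = c • (D x).apply l x
    rw [h1]
    rfl
  · refine ((D x₀).symbol.contMDiff x₀).congr_of_eventuallyEq ?_
    filter_upwards [hs x₀] with x hx
    rw [hx]
  · intro f l
    ext x
    exact (D x).leibniz_apply f l x

variable [T2Space M]

theorem exists_vecField_apply (H : HyperplaneDistribution E M) {x : M}
    (v : TangentSpace 𝓘(ℝ, E) x) :
    ∃ X : VecField 𝓘(ℝ, E) M, X x = v := by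
  obtain ⟨F⟩ := H.exists_adaptedFrame x
  refine ⟨∑ i, mvfderiv 𝓘(ℝ, E) (F.coord i) x v • F.field i, ?_⟩
  rw [section_sum_apply]
  conv_rhs => rw [eq_sum_dualField F.eventually_isCoordAt.self_of_nhds v]
  refine Finset.sum_congr rfl fun i _ ↦ ?_
  rw [← F.field_eq.self_of_nhds]
  rfl

namespace AdaptedFrame

variable {x₀ : M} (F : H.AdaptedFrame x₀)

/-- `Θ` vanishes on both derivations, so only the bracket term of `dΘ` remains, and the cutoffs in
the symbols are `1` near `x₀`. This is where the curvature of `H` enters `ω`. -/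
theorem symplecticAtiyahForm_conn {X Y : VecField 𝓘(ℝ, E) M} (hX : H.IsHorizontal X)
    (hY : H.IsHorizontal Y) :
    H.symplecticAtiyahForm.toBilin (F.conn X) (F.conn Y) x₀ = -H.curvature X Y x₀ := by
  rw [symplecticAtiyahForm_apply, F.conn_symbol, F.conn_symbol, map_smul, map_smul,
    thetaSection_eq_zero.2 hX, thetaSection_eq_zero.2 hY, smul_zero, Der.apply_zero,
    Der.apply_zero, sub_zero, zero_sub, section_neg_apply, curvature, thetaSection_apply,
    thetaSection_apply, VecField.bracket_cutoff_right _ _ F.cutoff_eq_one,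
    VecField.bracket_cutoff_left _ _ F.cutoff_eq_one]

end AdaptedFrame

theorem exists_horizontal {x₀ : M} {X : VecField 𝓘(ℝ, E) M} (hX : H.thetaSection X x₀ = 0) :
    ∃ Y : VecField 𝓘(ℝ, E) M, H.IsHorizontal Y ∧ Y x₀ = X x₀ := by
  obtain ⟨F⟩ := H.exists_adaptedFrame x₀
  obtain ⟨v, hv⟩ := LocalForm.theta_surjective (H := H) x₀ (F.gen x₀)
  obtain ⟨T, hT⟩ := H.exists_vecField_apply v
  have hg := F.gen_ne_zero.self_of_nhds
  have hcT : F.coeff (H.thetaSection T) x₀ = 1 := by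
    have h1 := F.eventually_coeff_smul.self_of_nhds (H.thetaSection T)
    rw [thetaSection_apply, hT, hv] at h1
    have h2 : (F.coeff (H.thetaSection T) x₀ - 1) • F.gen x₀ = 0 := by
      rw [sub_smul, h1, one_smul, sub_self]
    exact sub_eq_zero.1 ((smul_eq_zero.1 h2).resolve_right hg)
  have hcX : F.coeff (H.thetaSection X) x₀ = 0 := by
    have h1 := F.eventually_coeff_smul.self_of_nhds (H.thetaSection X)
    rw [hX] at h1
    exact (smul_eq_zero.1 h1).resolve_right hg
  -- Both terms have image `F.coeff (θ T) • F.coeff (θ X) • F.gen` under `θ`, so the difference is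
  -- horizontal everywhere. At `x₀` the coefficients are `1` and `0`, which leaves `X x₀`.
  refine ⟨F.coeff (H.thetaSection T) • F.cutoff • X - F.coeff (H.thetaSection X) • F.cutoff • T,
    ?_, ?_⟩
  · rw [← thetaSection_eq_zero, map_sub, map_smul, map_smul, map_smul, map_smul, F.cutoff_smul,
      F.cutoff_smul, smul_comm, sub_self]
  · simp only [section_sub_apply, smul_section_apply, hcT, hcX, F.cutoff_eq_one.self_of_nhds,
      one_smul, zero_smul, sub_zero]

/-- The Atiyah two-form `ω` of a contact structure is non-degenerate. -/
theorem IsContact.vanishesAt (hH : H.IsContact) {D : H.Der} {x : M}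
    (hD : ∀ D', H.symplecticAtiyahForm.toBilin D D' x = 0) : D.VanishesAt x := by
  obtain ⟨F⟩ := H.exists_adaptedFrame x
  -- Testing against the identity derivation shows that the symbol of `D` lies in `H` at `x`.
  have h1 : H.thetaSection D.symbol x = 0 := by
    rw [← symplecticAtiyahForm_euler, AtiyahTwoForm.swap, section_neg_apply, hD, neg_zero]
  obtain ⟨X, hX, hXx⟩ := exists_horizontal h1
  set c := F.coeff (D.apply F.gen) with hc
  have hcs := F.eventually_coeff_smul.self_of_nhds
  -- At `x`, `D` splits into a horizontal derivative and a multiple of the identity.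
  have h2 : ∀ l, D.apply l x = (F.conn X + c • H.euler).apply l x := by
    intro l
    rw [F.eventually_apply_eq.self_of_nhds D l]
    change mvfderiv 𝓘(ℝ, E) (F.coeff l) x (D.symbol x) • F.gen x + _ =
      mvfderiv 𝓘(ℝ, E) (F.coeff l) x (X x) • F.gen x + c x • l x
    rw [hXx, ← hcs (D.apply F.gen), smul_comm, hcs l]
  -- Against `F.conn Y` with `Y` horizontal, the multiple of the identity contributes `c • Θ = 0`,
  -- so the curvature pairs `X` trivially with `H` at `x`.
  have h3 : X x = 0 := by
    refine hH x X hX fun Y hY ↦ ?_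
    have h4 := hD (F.conn Y)
    rw [AtiyahTwoForm.apply_congr _ h2 fun _ ↦ rfl, map_add, LinearMap.add_apply, map_smul,
      LinearMap.smul_apply, symplecticAtiyahForm_euler, section_add_apply,
      F.symplecticAtiyahForm_conn hX hY, smul_section_apply, F.conn_symbol, map_smul,
      thetaSection_eq_zero.2 hY, smul_zero, section_zero_apply, smul_zero, add_zero] at h4
    exact neg_eq_zero.1 h4
  have h5 : ∀ l, D.apply l x = (c • H.euler).apply l x := by
    intro l
    rw [h2]
    change mvfderiv 𝓘(ℝ, E) (F.coeff l) x (X x) • F.gen x + c x • l x = c x • l x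
    rw [h3, map_zero, zero_smul, zero_add]
  -- What remains is `c` times the identity. It is tested against a vector field `T` transverse to
  -- `H`, on which `θ` takes the value `F.gen x`.
  have h6 : c x = 0 := by
    obtain ⟨v, hv⟩ := LocalForm.theta_surjective (H := H) x (F.gen x)
    obtain ⟨T, hT⟩ := H.exists_vecField_apply v
    have h7 := hD (F.conn T)
    rw [AtiyahTwoForm.apply_congr _ h5 fun _ ↦ rfl, map_smul, LinearMap.smul_apply,
      symplecticAtiyahForm_euler, F.conn_symbol, map_smul, smul_section_apply, smul_section_apply,
      thetaSection_apply, hT, hv, F.cutoff_eq_one.self_of_nhds, one_smul] at h7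
    exact (smul_eq_zero.1 h7).resolve_right F.gen_ne_zero.self_of_nhds
  intro l
  rw [h5, Der.smul_apply, smul_section_apply, h6, zero_smul]

theorem exists_local_inverse {g : C^∞⟮𝓘(ℝ, E), M; ℝ⟯} {x₀ : M} (hg : g x₀ ≠ 0) :
    ∃ d : C^∞⟮𝓘(ℝ, E), M; ℝ⟯, ∀ᶠ x in 𝓝 x₀, d x * g x = 1 := by
  have h1 : ∀ᶠ x in 𝓝 x₀, g x ≠ 0 := g.contMDiff.continuous.continuousAt.eventually_ne hg
  obtain ⟨d, hd⟩ := exists_extension (E := E) h1 (fun x ↦ (g x)⁻¹)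
    fun x hx ↦ (g.contMDiff x).inv₀ hx
  refine ⟨d, ?_⟩
  filter_upwards [h1, hd] with x hx hdx
  rw [hdx, inv_mul_cancel₀ hx]

/-- In a frame the equation `ω(D, -) = ψ` is a linear system over the smooth functions, solved by
Cramer's rule wherever the determinant is invertible. -/
theorem IsContact.exists_local_sharp (hH : H.IsContact) (ψ : H.AtiyahOneForm) (x₀ : M) :
    ∃ D : H.Der, ∀ᶠ x in 𝓝 x₀, ∀ D', H.symplecticAtiyahForm.toBilin D D' x = ψ D' x := by
  obtain ⟨F⟩ := H.exists_adaptedFrame x₀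
  set W : Matrix (Option (Fin (Module.finrank ℝ E))) (Option (Fin (Module.finrank ℝ E)))
      C^∞⟮𝓘(ℝ, E), M; ℝ⟯ :=
    Matrix.of fun a b ↦ F.coeff (H.symplecticAtiyahForm.toBilin (F.der a) (F.der b)) with hW
  have hcomb (c : Option (Fin (Module.finrank ℝ E)) → C^∞⟮𝓘(ℝ, E), M; ℝ⟯) (b) :
      F.coeff (H.symplecticAtiyahForm.toBilin (∑ a, c a • F.der a) (F.der b)) =
        Matrix.vecMul c W b := by
    simp only [map_sum, map_smul, LinearMap.sum_apply, LinearMap.smul_apply, Matrix.vecMul,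
      dotProduct, smul_eq_mul]
    rfl
  -- A null row vector of the matrix at `x₀` would be a combination of the frame lying in the kernel
  -- of `ω` at `x₀`. It vanishes there by non-degeneracy, hence so do its coefficients.
  have hdet : W.det x₀ ≠ 0 := by
    intro h0
    have h1 : (W.map (ContMDiffMap.evalRingHom (n := ∞) (I := 𝓘(ℝ, E)) (R := ℝ) x₀)).det = 0 := by
      rw [← RingHom.mapMatrix_apply, ← RingHom.map_det]
      exact h0
    obtain ⟨v, hv, hvW⟩ := Matrix.exists_vecMul_eq_zero_iff.2 h1
    apply hv
    set c : Option (Fin (Module.finrank ℝ E)) → C^∞⟮𝓘(ℝ, E), M; ℝ⟯ :=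
      fun a ↦ algebraMap ℝ _ (v a) with hc
    have hvan : (∑ a, c a • F.der a).VanishesAt x₀ := by
      refine hH.vanishesAt fun D' ↦ ?_
      rw [F.eventually_map_eq_sum.self_of_nhds]
      refine Finset.sum_eq_zero fun b _ ↦ ?_
      rw [← F.eventually_coeff_smul.self_of_nhds, hcomb]
      have h2 : Matrix.vecMul c W b x₀ = 0 := by
        have h3 := congrFun hvW b
        rw [Matrix.vecMul, dotProduct, function_sum_apply]
        exact h3
      rw [h2, zero_smul, smul_zero]
    funext a
    have h4 := F.comp_eq_zero hvan a
    rw [map_sum, function_sum_apply] at h4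
    simp only [map_smul, smul_eq_mul, function_mul_apply, F.eventually_comp_der.self_of_nhds] at h4
    exact (by simpa using h4 : c a x₀ = 0)
  obtain ⟨d, hd⟩ := exists_local_inverse hdet
  set p : Option (Fin (Module.finrank ℝ E)) → C^∞⟮𝓘(ℝ, E), M; ℝ⟯ :=
    fun b ↦ F.coeff (ψ (F.der b)) with hp
  -- Here `d` is a smooth function inverse to `det W` near `x₀`, so `c W = (d * det W) • p` equals
  -- `p` there.
  set c := Matrix.vecMul (d • p) W.adjugate with hc
  have hcW : Matrix.vecMul c W = (d * W.det) • p := by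
    rw [hc, Matrix.vecMul_vecMul, Matrix.adjugate_mul, Matrix.vecMul_smul, Matrix.vecMul_one,
      smul_smul, mul_comm]
  refine ⟨∑ a, c a • F.der a, ?_⟩
  filter_upwards [F.eventually_map_eq_sum, F.eventually_coeff_smul, hd] with x h1 h2 h3 D'
  rw [h1, h1 ψ]
  refine Finset.sum_congr rfl fun b _ ↦ ?_
  rw [← h2, ← h2 (ψ (F.der b)), hcomb, hcW]
  congr 2
  change (d x * W.det x) * p b x = p b x
  rw [h3, one_mul]

/-- The map `D ↦ ω(D, -)` from derivations to Atiyah one-forms is surjective. -/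
theorem IsContact.exists_sharp (hH : H.IsContact) (ψ : H.AtiyahOneForm) :
    ∃ D : H.Der, H.symplecticAtiyahForm.toBilin D = ψ := by
  choose D hD using hH.exists_local_sharp ψ
  -- Local solutions are unique pointwise by non-degeneracy, so they agree wherever both solve the
  -- equation.
  have h : ∀ x₀, ∀ᶠ x in 𝓝 x₀, ∀ l, (D x).apply l x = (D x₀).apply l x := by
    intro x₀
    filter_upwards [hD x₀] with x hx l
    have h1 : (D x - D x₀).VanishesAt x := hH.vanishesAt fun D' ↦ by
      rw [map_sub, LinearMap.sub_apply, section_sub_apply, hx, (hD x).self_of_nhds, sub_self]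
    exact sub_eq_zero.1 (h1 l)
  obtain ⟨D', hD'⟩ := Der.exists_glue D h
  refine ⟨D', LinearMap.ext fun D₂ ↦ ?_⟩
  ext x
  rw [AtiyahTwoForm.apply_congr _ (fun l ↦ hD' l x) fun _ ↦ rfl]
  exact (hD x).self_of_nhds D₂

theorem IsContact.symplecticAtiyahForm_injective (hH : H.IsContact) {D D' : H.Der}
    (h : H.symplecticAtiyahForm.toBilin D = H.symplecticAtiyahForm.toBilin D') : D = D' := by
  refine Der.ext_apply fun l ↦ ?_
  ext x
  have h1 : (D - D').VanishesAt x := hH.vanishesAt fun D₂ ↦ by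
    rw [map_sub, h, sub_self]
    rfl
  exact sub_eq_zero.1 (h1 l)

end HyperplaneDistribution

end Contact

/-! ### Hamiltonian contact fields, Jacobi bracket and Jacobi tensor -/

section Contact

variable {E : Type*} [NormedAddCommGroup E] [NormedSpace ℝ E] [FiniteDimensional ℝ E]
  {M : Type*} [TopologicalSpace M] [ChartedSpace E M] [IsManifold 𝓘(ℝ, E) ∞ M]

namespace HyperplaneDistribution

variable {H : HyperplaneDistribution E M} [T2Space M]

theorem jet_apply (l : H.NormalSection) (D : H.Der) : H.jet l D = D.apply l := rfl

theorem thetaSection_symbol_of_sharp {D : H.Der} {m : H.NormalSection}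
    (h : H.symplecticAtiyahForm.toBilin D = -H.jet m) : H.thetaSection D.symbol = m := by
  have h1 := congrArg (fun ψ : H.AtiyahOneForm ↦ ψ H.euler) h
  simp only [AtiyahTwoForm.swap _ D H.euler, symplecticAtiyahForm_euler, LinearMap.neg_apply,
    jet_apply, euler_apply, neg_inj] at h1
  exact h1

/-- Since `θ(σ(D)) = m`, the term `-D'(m)` in `dΘ(D, D')` cancels the right-hand side `-j¹m(D')`. -/
theorem apply_thetaSection_of_sharp {D : H.Der} {m : H.NormalSection}
    (h : H.symplecticAtiyahForm.toBilin D = -H.jet m) (D' : H.Der) :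
    D.apply (H.thetaSection D'.symbol) = H.thetaSection (D.symbol.bracket D'.symbol) := by
  have h1 := congrArg (fun ψ : H.AtiyahOneForm ↦ ψ D') h
  simp only [symplecticAtiyahForm_apply, thetaSection_symbol_of_sharp h, LinearMap.neg_apply,
    jet_apply] at h1
  rw [sub_right_comm, sub_eq_neg_self] at h1
  exact sub_eq_zero.1 h1

/-- For horizontal `Y`, take `D' = F.conn Y` in `apply_thetaSection_of_sharp`: the left side is `D 0
= 0`, and the cutoff in the symbol drops out at `x`. -/
theorem isContactVecField_of_sharp {D : H.Der} {m : H.NormalSection}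
    (h : H.symplecticAtiyahForm.toBilin D = -H.jet m) : H.IsContactVecField D.symbol := by
  intro Y hY x
  obtain ⟨F⟩ := H.exists_adaptedFrame x
  have h1 := apply_thetaSection_of_sharp h (F.conn Y)
  rw [F.conn_symbol, map_smul, thetaSection_eq_zero.2 hY, smul_zero, Der.apply_zero] at h1
  have h2 := congrArg (fun s : H.NormalSection ↦ s x) h1
  simp only [thetaSection_apply, VecField.bracket_cutoff_right _ _ F.cutoff_eq_one] at h2
  exact theta_eq_zero.1 h2.symm

/-- The difference is a horizontal contact vector field, so it lies in the kernel of the curvature.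
-/
theorem IsContact.contactVecField_unique (hH : H.IsContact) {X Y : VecField 𝓘(ℝ, E) M}
    (hX : H.IsContactVecField X) (hY : H.IsContactVecField Y)
    (h : H.thetaSection X = H.thetaSection Y) : X = Y := by
  ext x
  refine sub_eq_zero.1 (hH x (X - Y) ?_ fun Z hZ ↦ ?_)
  · rw [← thetaSection_eq_zero, map_sub, h, sub_self]
  · rw [curvature, VecField.bracket_sub_left, map_sub, thetaSection_eq_zero.2 (hX Z hZ),
      thetaSection_eq_zero.2 (hY Z hZ), sub_self]
    rfl

theorem IsContact.hamiltonianVecField_eq (hH : H.IsContact) {D : H.Der} {m : H.NormalSection}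
    (h : H.symplecticAtiyahForm.toBilin D = -H.jet m) : H.hamiltonianVecField m = D.symbol := by
  have hD : H.IsContactVecField D.symbol ∧ H.thetaSection D.symbol = m :=
    ⟨isContactVecField_of_sharp h, thetaSection_symbol_of_sharp h⟩
  have h1 : H.IsContactVecField (H.hamiltonianVecField m) ∧
      H.thetaSection (H.hamiltonianVecField m) = m :=
    Classical.epsilon_spec (p := fun X ↦ H.IsContactVecField X ∧ H.thetaSection X = m)
      ⟨D.symbol, hD⟩
  exact hH.contactVecField_unique h1.1 hD.1 (h1.2.trans hD.2.symm)

/-- The isomorphism `D ↦ ω(D, -)` of a contact structure. -/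
def IsContact.flat (hH : H.IsContact) : H.Der ≃ₗ[C^∞⟮𝓘(ℝ, E), M; ℝ⟯] H.AtiyahOneForm :=
  LinearEquiv.ofBijective H.symplecticAtiyahForm.toBilin
    ⟨fun _ _ h ↦ hH.symplecticAtiyahForm_injective h, hH.exists_sharp⟩

theorem IsContact.flat_symm (hH : H.IsContact) (ψ : H.AtiyahOneForm) :
    H.symplecticAtiyahForm.toBilin (hH.flat.symm ψ) = ψ :=
  hH.flat.apply_symm_apply ψ

/-- With `D = -flat⁻¹(j¹m)`, one has `θ([X_l, X_m]) = -θ([X_m, X_l]) = -D(l)`. The sign from the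
swap cancels the sign in `ω(D, -) = -j¹m`. -/
theorem IsContact.jacobiBracket_eq (hH : H.IsContact) (l m : H.NormalSection) :
    H.jacobiBracket l m = (hH.flat.symm (H.jet m)).apply l := by
  have h (l : H.NormalSection) :
      H.symplecticAtiyahForm.toBilin (-hH.flat.symm (H.jet l)) = -H.jet l := by
    rw [map_neg, hH.flat_symm]
  rw [jacobiBracket, hH.hamiltonianVecField_eq (h l), hH.hamiltonianVecField_eq (h m),
    VecField.bracket_swap, map_neg, ← apply_thetaSection_of_sharp (h m),
    thetaSection_symbol_of_sharp (h l)]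
  exact neg_neg _

/-- The inverse of the symplectic Atiyah form of a contact structure. -/
def IsContact.inverse (hH : H.IsContact) :
    AlternatingTwoForm C^∞⟮𝓘(ℝ, E), M; ℝ⟯ H.AtiyahOneForm H.NormalSection where
  toBilin := H.symplecticAtiyahForm.toBilin.compl₁₂ hH.flat.symm.toLinearMap
    hH.flat.symm.toLinearMap
  alt ψ := H.symplecticAtiyahForm.alt (hH.flat.symm ψ)

theorem IsContact.inverse_apply (hH : H.IsContact) (ψ χ : H.AtiyahOneForm) :
    hH.inverse.toBilin ψ χ = ψ (hH.flat.symm χ) := by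
  change H.symplecticAtiyahForm.toBilin (hH.flat.symm ψ) (hH.flat.symm χ) = _
  rw [hH.flat_symm]

theorem IsContact.isJacobiTensor_inverse (hH : H.IsContact) : H.IsJacobiTensor hH.inverse := by
  intro l m
  rw [hH.inverse_apply, hH.jacobiBracket_eq, jet_apply]

/-- Jets generate the Atiyah one-forms locally: `j¹(f t) - f j¹t` is the form `D ↦ σ(D)(f) t`, so
the jets of `t` and of the `u_i t` give a coframe, with `t` the generator and `u_i` the coordinates.
-/
theorem exists_smul_mem_span_jet (x₀ : M) : ∃ k : C^∞⟮𝓘(ℝ, E), M; ℝ⟯, k x₀ = 1 ∧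
    ∀ ψ : H.AtiyahOneForm, k • ψ ∈ Submodule.span C^∞⟮𝓘(ℝ, E), M; ℝ⟯ (range H.jet) := by
  obtain ⟨F⟩ := H.exists_adaptedFrame x₀
  obtain ⟨U, hU, hUo, hxU⟩ := eventually_nhds_iff.1
    (F.eventually_map_eq_sum.and F.eventually_coeff_smul)
  obtain ⟨k, hk1, hk⟩ := exists_bump (E := E) (hUo.mem_nhds hxU)
  refine ⟨k, hk1.self_of_nhds, fun ψ ↦ ?_⟩
  have h1 : k • ψ = (k * F.coeff (ψ (F.der none))) • H.jet F.gen +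
      ∑ i, (k * F.coeff (ψ (F.der (some i)))) •
        (H.jet (F.coord i • F.gen) - F.coord i • H.jet F.gen) := by
    refine LinearMap.ext fun D ↦ ?_
    ext y
    have h2 (i) : H.jet (F.coord i • F.gen) D - F.coord i • H.jet F.gen D =
        F.comp (some i) D • F.gen := by
      rw [jet_apply, jet_apply, D.leibniz, add_sub_cancel_right]
      rfl
    simp only [LinearMap.add_apply, LinearMap.sum_apply, LinearMap.smul_apply, LinearMap.sub_apply,
      h2, section_add_apply, section_sum_apply, smul_section_apply, function_mul_apply]
    by_cases hy : y ∈ U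
    · obtain ⟨h3, h4⟩ := hU y hy
      rw [h3, Fintype.sum_option, smul_add, Finset.smul_sum]
      congr 1
      · rw [jet_apply, ← h4 (ψ (F.der none)), ← h4 (D.apply F.gen), smul_smul, smul_smul,
          smul_smul, mul_right_comm]
        rfl
      · refine Finset.sum_congr rfl fun i _ ↦ ?_
        rw [← h4 (ψ (F.der (some i))), smul_smul, smul_smul, smul_smul, mul_right_comm]
    · have h3 : k y = 0 := image_eq_zero_of_notMem_tsupport fun h ↦ hy (hk h)
      simp [h3]
  have hj (l : H.NormalSection) :
      H.jet l ∈ Submodule.span C^∞⟮𝓘(ℝ, E), M; ℝ⟯ (range H.jet) :=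
    Submodule.subset_span (mem_range_self l)
  rw [h1]
  exact Submodule.add_mem _ (Submodule.smul_mem _ _ (hj _)) (Submodule.sum_mem _ fun i _ ↦
    Submodule.smul_mem _ _ (Submodule.sub_mem _ (hj _) (Submodule.smul_mem _ _ (hj _))))

/-- The two tensors agree on jets, hence on their span, one slot at a time. Multiplying each
argument by `k` with `k x = 1` brings it into the span without changing the value at `x`. -/
theorem IsJacobiTensor.unique
    {J J' : AlternatingTwoForm C^∞⟮𝓘(ℝ, E), M; ℝ⟯ H.AtiyahOneForm H.NormalSection}
    (hJ : H.IsJacobiTensor J) (hJ' : H.IsJacobiTensor J') (ψ χ : H.AtiyahOneForm) :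
    J.toBilin ψ χ = J'.toBilin ψ χ := by
  ext x
  obtain ⟨k, hk, h⟩ := exists_smul_mem_span_jet (H := H) x
  have h1 (l : H.NormalSection) : J.toBilin (H.jet l) (k • χ) = J'.toBilin (H.jet l) (k • χ) := by
    refine LinearMap.eqOn_span (f := J.toBilin (H.jet l)) (g := J'.toBilin (H.jet l)) ?_ (h χ)
    rintro _ ⟨m, rfl⟩
    rw [hJ, hJ']
  have h2 : J.toBilin.flip (k • χ) (k • ψ) = J'.toBilin.flip (k • χ) (k • ψ) := by
    refine LinearMap.eqOn_span ?_ (h ψ)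
    rintro _ ⟨l, rfl⟩
    exact h1 l
  have h3 := congrArg (fun s : H.NormalSection ↦ s x) h2
  simp only [LinearMap.flip_apply, map_smul, LinearMap.smul_apply, smul_section_apply, hk,
    one_smul] at h3
  exact h3

theorem IsContact.jacobiTensor_apply (hH : H.IsContact) (ψ χ : H.AtiyahOneForm) :
    H.jacobiTensor.toBilin ψ χ = ψ (hH.flat.symm χ) := by
  have h1 : H.IsJacobiTensor H.jacobiTensor :=
    Classical.epsilon_spec (p := H.IsJacobiTensor) ⟨_, hH.isJacobiTensor_inverse⟩
  rw [← hH.inverse_apply]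
  exact h1.unique hH.isJacobiTensor_inverse ψ χ

end HyperplaneDistribution

end Contact

/-! ### Coordinates on `L̃` and lifts of derivations -/

section Contact

variable {E : Type*} [NormedAddCommGroup E] [NormedSpace ℝ E] [FiniteDimensional ℝ E]
  {M : Type*} [TopologicalSpace M] [ChartedSpace E M] [IsManifold 𝓘(ℝ, E) ∞ M]

namespace HyperplaneDistribution

variable (H : HyperplaneDistribution E M)

theorem contMDiff_coneProj : ContMDiff (𝓘(ℝ, E).prod 𝓘(ℝ, ℝ →L[ℝ] ℝ)) 𝓘(ℝ, E) ∞
    (fun ε : H.Cone ↦ ε.1.1) :=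
  (contMDiff_proj H.Dual).comp contMDiff_subtype_val

/-- The pullback of a smooth function to `L̃`. -/
def pull (f : C^∞⟮𝓘(ℝ, E), M; ℝ⟯) : C^∞⟮𝓘(ℝ, E).prod 𝓘(ℝ, ℝ →L[ℝ] ℝ), H.Cone; ℝ⟯ :=
  ⟨fun ε ↦ f ε.1.1, f.contMDiff.comp H.contMDiff_coneProj⟩

variable {H}

theorem lift_apply (l : H.NormalSection) (ε : H.Cone) : H.lift l ε = ε.1.2 (l ε.1.1) := rfl

theorem lift_add (l m : H.NormalSection) : H.lift (l + m) = H.lift l + H.lift m := by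
  ext ε
  exact map_add ε.1.2 (l ε.1.1) (m ε.1.1)

theorem lift_smul (f : C^∞⟮𝓘(ℝ, E), M; ℝ⟯) (l : H.NormalSection) :
    H.lift (f • l) = H.pull f * H.lift l := by
  ext ε
  exact map_smul ε.1.2 (f ε.1.1) (l ε.1.1)

theorem eventually_cone {ε₀ : H.Cone} {p : M → Prop} (h : ∀ᶠ x in 𝓝 ε₀.1.1, p x) :
    ∀ᶠ ε : H.Cone in 𝓝 ε₀, p ε.1.1 :=
  H.contMDiff_coneProj.continuous.continuousAt.eventually h

/-- The coordinates of `E × Hom(ℝ, ℝ)`. -/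
def coneModelEquiv (E : Type*) [NormedAddCommGroup E] [NormedSpace ℝ E] [FiniteDimensional ℝ E] :
    (E × (ℝ →L[ℝ] ℝ)) ≃L[ℝ] (Option (Fin (Module.finrank ℝ E)) → ℝ) :=
  LinearEquiv.toContinuousLinearEquiv
    { toFun := fun p a ↦ a.elim (p.2 1) fun i ↦ (Module.finBasis ℝ E).equivFun p.1 i
      map_add' := fun p q ↦ by
        funext a
        cases a <;> simp
      map_smul' := fun c p ↦ by
        funext a
        cases a <;> simp
      invFun := fun w ↦ ((Module.finBasis ℝ E).equivFun.symm fun i ↦ w (some i),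
        w none • ContinuousLinearMap.id ℝ ℝ)
      left_inv := fun p ↦ by
        refine Prod.ext ?_ ?_
        · exact (Module.finBasis ℝ E).equivFun.symm_apply_apply p.1
        · ext
          simp
      right_inv := fun w ↦ by
        funext a
        cases a with
        | none => simp
        | some i =>
          exact congrFun ((Module.finBasis ℝ E).equivFun.apply_symm_apply fun i ↦ w (some i)) i }

namespace AdaptedFrame

/-- The coordinates on `L̃` given by a frame. -/
def coneCoord {x₀ : M} (F : H.AdaptedFrame x₀) : Option (Fin (Module.finrank ℝ E)) →
    C^∞⟮𝓘(ℝ, E).prod 𝓘(ℝ, ℝ →L[ℝ] ℝ), H.Cone; ℝ⟯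
  | none => H.lift F.gen
  | some i => H.pull (F.coord i)

/-- The fibre coordinate of the dual trivialization is evaluation on the vector corresponding to
`1`, and `F.gen` is that vector near the base point by `gen_eq`. -/
theorem coneCoord_eventuallyEq {ε₀ : H.Cone} (F : H.AdaptedFrame ε₀.1.1) :
    coordMap F.coneCoord =ᶠ[𝓝 ε₀]
      coneModelEquiv E ∘ extChartAt (𝓘(ℝ, E).prod 𝓘(ℝ, ℝ →L[ℝ] ℝ)) ε₀ := by
  have hb : ∀ᶠ x in 𝓝 ε₀.1.1, x ∈ (trivializationAt ℝ H.Normal ε₀.1.1).baseSet :=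
    (trivializationAt ℝ H.Normal ε₀.1.1).open_baseSet.mem_nhds
      (mem_baseSet_trivializationAt ℝ H.Normal ε₀.1.1)
  filter_upwards [eventually_cone F.coord_eq, eventually_cone F.gen_eq,
    eventually_cone hb] with ε h1 h2 h3
  have h4 : extChartAt (𝓘(ℝ, E).prod 𝓘(ℝ, ℝ →L[ℝ] ℝ)) ε₀ ε =
      extChartAt (𝓘(ℝ, E).prod 𝓘(ℝ, ℝ →L[ℝ] ℝ)) ε₀.1 ε.1 := rfl
  rw [Function.comp_apply, h4, FiberBundle.extChartAt]
  funext a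
  cases a with
  | none =>
    change ε.1.2 (F.gen ε.1.1) = (trivializationAt (ℝ →L[ℝ] ℝ) H.Dual ε₀.1.1 ε.1).2 1
    rw [hom_trivializationAt_apply, h2]
    simp [ContinuousLinearMap.inCoordinates, Trivialization.symmL_apply, h3]
  | some i => exact congrFun h1 i

theorem eventually_isCoordAt_cone {ε₀ : H.Cone} (F : H.AdaptedFrame ε₀.1.1) :
    ∀ᶠ ε in 𝓝 ε₀, IsCoordAt F.coneCoord ε :=
  ContactGeom.eventually_isCoordAt _ F.coneCoord_eventuallyEq

end AdaptedFrame

variable [T2Space M]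

theorem exists_section_apply {x : M} (v : H.Normal x) : ∃ l : H.NormalSection, l x = v := by
  obtain ⟨w, rfl⟩ := LocalForm.theta_surjective (H := H) x v
  obtain ⟨X, rfl⟩ := H.exists_vecField_apply w
  exact ⟨H.thetaSection X, rfl⟩

namespace AdaptedFrame

/-- A covector vanishing on `F.gen` vanishes on the whole line `L_x`, while points of `L̃` are
nonzero covectors. -/
theorem eventually_lift_gen_ne_zero {ε₀ : H.Cone} (F : H.AdaptedFrame ε₀.1.1) :
    ∀ᶠ ε in 𝓝 ε₀, H.lift F.gen ε ≠ 0 := by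
  filter_upwards [eventually_cone F.eventually_coeff_smul] with ε h1 h2
  apply ε.2
  refine ContinuousLinearMap.ext fun v ↦ ?_
  obtain ⟨l, rfl⟩ := exists_section_apply v
  rw [← h1 l, map_smul]
  exact (congrArg (F.coeff l ε.1.1 • ·) h2).trans (smul_zero _)

theorem eventually_mvfderiv_pull {ε₀ : H.Cone} (F : H.AdaptedFrame ε₀.1.1) :
    ∀ᶠ ε in 𝓝 ε₀, ∀ (f : C^∞⟮𝓘(ℝ, E), M; ℝ⟯)
      (v : TangentSpace (𝓘(ℝ, E).prod 𝓘(ℝ, ℝ →L[ℝ] ℝ)) ε),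
      mvfderiv _ (H.pull f) ε v =
        ∑ i, mvfderiv _ (H.pull (F.coord i)) ε v * (F.field i).deriv f ε.1.1 := by
  filter_upwards [eventually_cone F.eventually_isCoordAt, eventually_cone F.field_eq]
    with ε h1 h2 f v
  have h3 (g : C^∞⟮𝓘(ℝ, E), M; ℝ⟯) : mvfderiv (𝓘(ℝ, E).prod 𝓘(ℝ, ℝ →L[ℝ] ℝ)) (H.pull g) ε v =
      mvfderiv 𝓘(ℝ, E) g ε.1.1
        (mfderiv (𝓘(ℝ, E).prod 𝓘(ℝ, ℝ →L[ℝ] ℝ)) 𝓘(ℝ, E) (fun ε : H.Cone ↦ ε.1.1) ε v) :=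
    mvfderiv_comp_apply (I := 𝓘(ℝ, E)) (I' := 𝓘(ℝ, E).prod 𝓘(ℝ, ℝ →L[ℝ] ℝ)) ε
      (mdifferentiableAt_smooth g ε.1.1)
      (H.contMDiff_coneProj.mdifferentiableAt (by simp)) v
  simp only [h3, VecField.deriv_apply, h2]
  conv_lhs => rw [eq_sum_dualField h1 (mfderiv (𝓘(ℝ, E).prod 𝓘(ℝ, ℝ →L[ℝ] ℝ)) 𝓘(ℝ, E)
    (fun ε : H.Cone ↦ ε.1.1) ε v), map_sum]
  simp

end AdaptedFrame

theorem mvfderiv_lift_smul (f : C^∞⟮𝓘(ℝ, E), M; ℝ⟯) (l : H.NormalSection) (ε : H.Cone)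
    (v : TangentSpace (𝓘(ℝ, E).prod 𝓘(ℝ, ℝ →L[ℝ] ℝ)) ε) :
    mvfderiv _ (H.lift (f • l)) ε v =
      mvfderiv _ (H.pull f) ε v * H.lift l ε + f ε.1.1 * mvfderiv _ (H.lift l) ε v := by
  rw [lift_smul]
  exact mvfderiv_smooth_mul (H.pull f) (H.lift l) ε v

/-- The differentials of the functions `λ̃` span the cotangent spaces of `L̃`. -/
theorem cone_tangent_ext {ε : H.Cone} {v w : TangentSpace (𝓘(ℝ, E).prod 𝓘(ℝ, ℝ →L[ℝ] ℝ)) ε}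
    (h : ∀ l : H.NormalSection, mvfderiv _ (H.lift l) ε v = mvfderiv _ (H.lift l) ε w) :
    v = w := by
  obtain ⟨F⟩ := H.exists_adaptedFrame ε.1.1
  refine ext_of_isCoordAt F.eventually_isCoordAt_cone.self_of_nhds fun a ↦ ?_
  cases a with
  | none => exact h F.gen
  | some i =>
    -- The lift of this section is the product of the coordinate and the lift of `F.gen`. Since that
    -- lift is nonzero at `ε`, the differential of the coordinate can be isolated.
    have h1 := h (F.coord i • F.gen)
    rw [mvfderiv_lift_smul, mvfderiv_lift_smul, h, add_left_inj] at h1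
    exact mul_right_cancel₀ F.eventually_lift_gen_ne_zero.self_of_nhds h1

namespace AdaptedFrame

/-- The coordinate expression of the lift of a derivation to `L̃`. -/
def localLift {x₀ : M} (F : H.AdaptedFrame x₀) (D : H.Der) (ε : H.Cone) :
    TangentSpace (𝓘(ℝ, E).prod 𝓘(ℝ, ℝ →L[ℝ] ℝ)) ε :=
  ∑ a : Option (Fin (Module.finrank ℝ E)),
    (a.elim (H.lift (D.apply F.gen)) fun i ↦ H.pull (D.symbol.deriv (F.coord i))) ε •
      dualField F.coneCoord a ε

theorem contMDiffAt_localLift {ε₀ : H.Cone} (F : H.AdaptedFrame ε₀.1.1) (D : H.Der) :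
    ContMDiffAt (𝓘(ℝ, E).prod 𝓘(ℝ, ℝ →L[ℝ] ℝ)) (𝓘(ℝ, E).prod 𝓘(ℝ, ℝ →L[ℝ] ℝ)).tangent ∞
      (fun ε ↦ (TotalSpace.mk ε (F.localLift D ε) :
        TangentBundle (𝓘(ℝ, E).prod 𝓘(ℝ, ℝ →L[ℝ] ℝ)) H.Cone)) ε₀ :=
  ContMDiffAt.sum_section fun a _ ↦ (ContMDiffMap.contMDiff _ ε₀).smul_section
    (contMDiffAt_dualField F.eventually_isCoordAt_cone.self_of_nhds a)

theorem eventually_localLift {ε₀ : H.Cone} (F : H.AdaptedFrame ε₀.1.1) (D : H.Der) :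
    ∀ᶠ ε in 𝓝 ε₀, ∀ l : H.NormalSection,
      mvfderiv _ (H.lift l) ε (F.localLift D ε) = H.lift (D.apply l) ε := by
  filter_upwards [F.eventually_isCoordAt_cone, F.eventually_mvfderiv_pull,
    eventually_cone F.eventually_apply_eq, eventually_cone F.eventually_deriv_eq_sum,
    eventually_cone F.eventually_coeff_smul.eventually_nhds] with ε h1 h2 h3 h4 h5 l
  have hc (b : Option (Fin (Module.finrank ℝ E))) :
      mvfderiv _ (F.coneCoord b) ε (F.localLift D ε) =
        (b.elim (H.lift (D.apply F.gen)) fun i ↦ H.pull (D.symbol.deriv (F.coord i))) ε :=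
    mvfderiv_sum_dualField h1 _ b
  -- Every section is locally a multiple of `F.gen`, so it is enough to know the action on the lift
  -- of `F.gen` and on pulled-back functions, which the coordinates prescribe.
  have h6 : H.lift l =ᶠ[𝓝 ε] H.lift (F.coeff l • F.gen) := by
    filter_upwards [eventually_cone h5] with ε' h7
    rw [lift_apply, lift_apply, smul_section_apply, h7]
  have hn : mvfderiv _ (H.lift F.gen) ε (F.localLift D ε) = H.lift (D.apply F.gen) ε := hc none
  have hs (i) : mvfderiv _ (H.pull (F.coord i)) ε (F.localLift D ε) =
    D.symbol.deriv (F.coord i) ε.1.1 := hc (some i)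
  rw [mvfderiv_congr h6, mvfderiv_lift_smul, hn, h2]
  simp only [hs]
  rw [← h4, lift_apply, lift_apply, lift_apply, h3 D l, map_add, map_smul, map_smul]
  rfl

end AdaptedFrame

/-- A vector field satisfying the condition exists: the local lifts in different frames coincide by
`cone_tangent_ext`, so they form a smooth global field. -/
theorem liftDer_deriv (D : H.Der) (l : H.NormalSection) :
    (H.liftDer D).deriv (H.lift l) = H.lift (D.apply l) := by
  have F (x : M) : H.AdaptedFrame x := (H.exists_adaptedFrame x).some
  have hV : ∃ V : H.ConeVecField, ∀ l : H.NormalSection,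
      V.deriv (H.lift l) = H.lift (D.apply l) := by
    refine ⟨⟨fun ε ↦ (F ε.1.1).localLift D ε, fun ε₀ ↦ ?_⟩, fun l ↦ ?_⟩
    · refine ((F ε₀.1.1).contMDiffAt_localLift D).congr_of_eventuallyEq ?_
      filter_upwards [(F ε₀.1.1).eventually_localLift D] with ε hε
      have h1 : (F ε.1.1).localLift D ε = (F ε₀.1.1).localLift D ε :=
        cone_tangent_ext fun l ↦
          (((F ε.1.1).eventually_localLift D).self_of_nhds l).trans (hε l).symm
      rw [h1]
    · ext ε
      exact ((F ε.1.1).eventually_localLift D).self_of_nhds l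
  exact Classical.epsilon_spec (p := fun V : H.ConeVecField ↦ ∀ l : H.NormalSection,
    V.deriv (H.lift l) = H.lift (D.apply l)) hV l

theorem mvfderiv_lift_liftDer (D : H.Der) (l : H.NormalSection) (ε : H.Cone) :
    mvfderiv _ (H.lift l) ε (H.liftDer D ε) = H.lift (D.apply l) ε :=
  congrArg (fun f : C^∞⟮𝓘(ℝ, E).prod 𝓘(ℝ, ℝ →L[ℝ] ℝ), H.Cone; ℝ⟯ ↦ f ε) (liftDer_deriv D l)

/-- The lift of `D` projects to its symbol: differentiate the lift of `f • F.gen` by both Leibniz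
rules and cancel the nonzero factor. -/
theorem mvfderiv_pull_liftDer (D : H.Der) (f : C^∞⟮𝓘(ℝ, E), M; ℝ⟯) (ε : H.Cone) :
    mvfderiv _ (H.pull f) ε (H.liftDer D ε) = D.symbol.deriv f ε.1.1 := by
  obtain ⟨F⟩ := H.exists_adaptedFrame ε.1.1
  have h1 := mvfderiv_lift_smul f F.gen ε (H.liftDer D ε)
  rw [mvfderiv_lift_liftDer, mvfderiv_lift_liftDer, D.leibniz, lift_add, lift_smul, lift_smul]
    at h1
  have h2 : D.symbol.deriv f ε.1.1 * H.lift F.gen ε + f ε.1.1 * H.lift (D.apply F.gen) ε =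
    mvfderiv _ (H.pull f) ε (H.liftDer D ε) * H.lift F.gen ε +
      f ε.1.1 * H.lift (D.apply F.gen) ε := h1
  rw [add_left_inj] at h2
  exact (mul_right_cancel₀ F.eventually_lift_gen_ne_zero.self_of_nhds h2).symm

end HyperplaneDistribution

end Contact

/-! ### The Poisson tensor of a two-form at a point -/

section Poisson

variable {E : Type*} [NormedAddCommGroup E] [NormedSpace ℝ E]
  {B : Type*} [TopologicalSpace B] {I : ModelWithCorners ℝ E B}
  {N : Type*} [TopologicalSpace N] [ChartedSpace B N] [IsManifold I ∞ N]

theorem DiffTwoForm.swap (η : DiffTwoForm I N) (p : N) (v w : TangentSpace I p) :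
    η.toFun p v w = -η.toFun p w v := by
  have h := η.alt p (v + w)
  simp only [map_add, LinearMap.add_apply, η.alt, zero_add, add_zero] at h
  exact eq_neg_of_add_eq_zero_right h

/-- Any two solutions of `η(v, -) = α` differ by an element of the kernel of `η`, so any
representatives may replace those chosen by `sharp`. Non-degeneracy is not needed. -/
theorem DiffTwoForm.poissonTensor_eq (η : DiffTwoForm I N) {p : N}
    {α β : TangentSpace I p →ₗ[ℝ] ℝ} {a b : TangentSpace I p} (ha : η.toFun p a = α)
    (hb : η.toFun p b = β) : η.poissonTensor p α β = η.toFun p a b := by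
  have hα : η.toFun p (η.sharp p α) = α :=
    Classical.epsilon_spec (p := fun v ↦ η.toFun p v = α) ⟨a, ha⟩
  have hβ : η.toFun p (η.sharp p β) = β :=
    Classical.epsilon_spec (p := fun v ↦ η.toFun p v = β) ⟨b, hb⟩
  rw [DiffTwoForm.poissonTensor, hα, ← ha, η.swap, hβ, ← hb, ← η.swap]

end Poisson

/-! ### Lifts of Atiyah forms and inversion of `ω̃` -/

section Contact

variable {E : Type*} [NormedAddCommGroup E] [NormedSpace ℝ E] [FiniteDimensional ℝ E]
  {M : Type*} [TopologicalSpace M] [ChartedSpace E M] [IsManifold 𝓘(ℝ, E) ∞ M]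

namespace HyperplaneDistribution

variable {H : HyperplaneDistribution E M}

namespace AdaptedFrame

variable {x₀ : M} (F : H.AdaptedFrame x₀)

/-- The coframe on `L̃` dual to the lifts of the derivations of the frame. -/
def coframe (ε : H.Cone) : Option (Fin (Module.finrank ℝ E)) →
    TangentSpace (𝓘(ℝ, E).prod 𝓘(ℝ, ℝ →L[ℝ] ℝ)) ε →ₗ[ℝ] ℝ
  | none => (H.lift F.gen ε)⁻¹ • (mvfderiv _ (H.lift F.gen) ε).toLinearMap
  | some i => (mvfderiv _ (H.pull (F.coord i)) ε).toLinearMap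

/-- The lift of an Atiyah one-form in terms of the coframe. -/
def localOneForm (ψ : H.AtiyahOneForm) (ε : H.Cone) :
    TangentSpace (𝓘(ℝ, E).prod 𝓘(ℝ, ℝ →L[ℝ] ℝ)) ε →ₗ[ℝ] ℝ :=
  ∑ a, H.lift (ψ (F.der a)) ε • F.coframe ε a

/-- The lift of an Atiyah two-form in terms of the coframe. -/
def localTwoForm (η : H.AtiyahTwoForm) (ε : H.Cone) :
    TangentSpace (𝓘(ℝ, E).prod 𝓘(ℝ, ℝ →L[ℝ] ℝ)) ε →ₗ[ℝ]
      TangentSpace (𝓘(ℝ, E).prod 𝓘(ℝ, ℝ →L[ℝ] ℝ)) ε →ₗ[ℝ] ℝ :=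
  ∑ a, (F.coframe ε a).smulRight (F.localOneForm (η.toBilin (F.der a)) ε)

theorem localOneForm_apply (ψ : H.AtiyahOneForm) (ε : H.Cone)
    (v : TangentSpace (𝓘(ℝ, E).prod 𝓘(ℝ, ℝ →L[ℝ] ℝ)) ε) :
    F.localOneForm ψ ε v = ∑ a, H.lift (ψ (F.der a)) ε * F.coframe ε a v := by
  rw [localOneForm, LinearMap.sum_apply]
  rfl

theorem localTwoForm_apply (η : H.AtiyahTwoForm) (ε : H.Cone)
    (v w : TangentSpace (𝓘(ℝ, E).prod 𝓘(ℝ, ℝ →L[ℝ] ℝ)) ε) :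
    F.localTwoForm η ε v w =
      ∑ a, F.coframe ε a v * F.localOneForm (η.toBilin (F.der a)) ε w := by
  rw [localTwoForm, LinearMap.sum_apply, LinearMap.sum_apply]
  rfl

end AdaptedFrame

variable [T2Space M]

namespace AdaptedFrame

theorem contMDiffAt_coframe {ε₀ : H.Cone} (F : H.AdaptedFrame ε₀.1.1) (X : H.ConeVecField) (a) :
    ContMDiffAt (𝓘(ℝ, E).prod 𝓘(ℝ, ℝ →L[ℝ] ℝ)) 𝓘(ℝ, ℝ) ∞ (fun ε ↦ F.coframe ε a (X ε)) ε₀ := by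
  cases a with
  | none =>
    exact (((H.lift F.gen).contMDiff ε₀).inv₀ F.eventually_lift_gen_ne_zero.self_of_nhds).mul
      ((X.deriv (H.lift F.gen)).contMDiff ε₀)
  | some i => exact (X.deriv (H.pull (F.coord i))).contMDiff ε₀

theorem contMDiffAt_localOneForm {ε₀ : H.Cone} (F : H.AdaptedFrame ε₀.1.1)
    (ψ : H.AtiyahOneForm) (X : H.ConeVecField) :
    ContMDiffAt (𝓘(ℝ, E).prod 𝓘(ℝ, ℝ →L[ℝ] ℝ)) 𝓘(ℝ, ℝ) ∞
      (fun ε ↦ F.localOneForm ψ ε (X ε)) ε₀ := by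
  simp only [localOneForm_apply]
  exact contMDiffAt_finsetSum fun a _ ↦
    ((H.lift (ψ (F.der a))).contMDiff ε₀).mul (F.contMDiffAt_coframe X a)

theorem contMDiffAt_localTwoForm {ε₀ : H.Cone} (F : H.AdaptedFrame ε₀.1.1)
    (η : H.AtiyahTwoForm) (X Y : H.ConeVecField) :
    ContMDiffAt (𝓘(ℝ, E).prod 𝓘(ℝ, ℝ →L[ℝ] ℝ)) 𝓘(ℝ, ℝ) ∞
      (fun ε ↦ F.localTwoForm η ε (X ε) (Y ε)) ε₀ := by
  simp only [localTwoForm_apply]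
  exact contMDiffAt_finsetSum fun a _ ↦
    (F.contMDiffAt_coframe X a).mul (F.contMDiffAt_localOneForm _ Y)

/-- Near the base point the lift of `D` multiplies the lift of `F.gen` by `F.coeff (D.apply F.gen)`.
The inverse factor in `coframe` removes that lift. -/
theorem eventually_coframe_liftDer {ε₀ : H.Cone} (F : H.AdaptedFrame ε₀.1.1) :
    ∀ᶠ ε in 𝓝 ε₀, ∀ (D : H.Der) (a), F.coframe ε a (H.liftDer D ε) = F.comp a D ε.1.1 := by
  filter_upwards [F.eventually_lift_gen_ne_zero, eventually_cone F.eventually_coeff_smul]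
    with ε h1 h2 D a
  cases a with
  | none =>
    have h3 : mvfderiv _ (H.lift F.gen) ε (H.liftDer D ε) =
        F.coeff (D.apply F.gen) ε.1.1 * H.lift F.gen ε := by
      rw [mvfderiv_lift_liftDer, lift_apply, ← h2 (D.apply F.gen), map_smul]
      rfl
    change (H.lift F.gen ε)⁻¹ * mvfderiv _ (H.lift F.gen) ε (H.liftDer D ε) = _
    rw [h3, mul_comm, mul_assoc, mul_inv_cancel₀ h1, mul_one]
    rfl
  | some i => exact mvfderiv_pull_liftDer D (F.coord i) ε

theorem eventually_localOneForm {ε₀ : H.Cone} (F : H.AdaptedFrame ε₀.1.1) :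
    ∀ᶠ ε in 𝓝 ε₀, ∀ (ψ : H.AtiyahOneForm) (D : H.Der),
      F.localOneForm ψ ε (H.liftDer D ε) = H.lift (ψ D) ε := by
  filter_upwards [F.eventually_coframe_liftDer, eventually_cone F.eventually_map_eq_sum]
    with ε h1 h2 ψ D
  rw [localOneForm_apply, lift_apply, h2, map_sum]
  refine Finset.sum_congr rfl fun a _ ↦ ?_
  rw [h1, map_smul, mul_comm]
  rfl

theorem eventually_localTwoForm {ε₀ : H.Cone} (F : H.AdaptedFrame ε₀.1.1) :
    ∀ᶠ ε in 𝓝 ε₀, ∀ (η : H.AtiyahTwoForm) (D D' : H.Der),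
      F.localTwoForm η ε (H.liftDer D ε) (H.liftDer D' ε) = H.lift (η.toBilin D D') ε := by
  filter_upwards [F.eventually_coframe_liftDer, F.eventually_localOneForm,
    eventually_cone F.eventually_map_eq_sum] with ε h1 h2 h3 η D D'
  rw [localTwoForm_apply, lift_apply, AtiyahTwoForm.swap, section_neg_apply, h3, map_neg, map_sum,
    ← Finset.sum_neg_distrib]
  refine Finset.sum_congr rfl fun a _ ↦ ?_
  rw [h1, h2, map_smul, AtiyahTwoForm.swap, lift_apply, section_neg_apply, map_neg]
  exact mul_neg _ _

end AdaptedFrame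

/-- The lifts of derivations span the tangent spaces of `L̃`. -/
theorem exists_liftDer_eq {ε : H.Cone} (v : TangentSpace (𝓘(ℝ, E).prod 𝓘(ℝ, ℝ →L[ℝ] ℝ)) ε) :
    ∃ D : H.Der, H.liftDer D ε = v := by
  obtain ⟨F⟩ := H.exists_adaptedFrame ε.1.1
  -- Only the value at `ε` matters, so constant coefficients read off from the coframe suffice.
  refine ⟨∑ a, algebraMap ℝ C^∞⟮𝓘(ℝ, E), M; ℝ⟯ (F.coframe ε a v) • F.der a, ?_⟩
  have h1 (a) : F.coframe ε a (H.liftDer (∑ a, algebraMap ℝ C^∞⟮𝓘(ℝ, E), M; ℝ⟯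
      (F.coframe ε a v) • F.der a) ε) = F.coframe ε a v := by
    rw [F.eventually_coframe_liftDer.self_of_nhds, map_sum, function_sum_apply]
    simp only [map_smul, smul_eq_mul, function_mul_apply, F.eventually_comp_der.self_of_nhds,
      mul_ite, mul_one, mul_zero, Finset.sum_ite_eq, Finset.mem_univ, if_true]
    rfl
  refine ext_of_isCoordAt F.eventually_isCoordAt_cone.self_of_nhds fun a ↦ ?_
  cases a with
  | none =>
    exact mul_left_cancel₀ (inv_ne_zero F.eventually_lift_gen_ne_zero.self_of_nhds) (h1 none)
  | some i => exact h1 (some i)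

/-- The forms defined by different frames coincide because lifts of derivations fill the tangent
spaces. This makes the form smooth, so a lift exists. -/
theorem liftOneForm_liftDer (ψ : H.AtiyahOneForm) (D : H.Der) (ε : H.Cone) :
    (H.liftOneForm ψ).toFun ε (H.liftDer D ε) = H.lift (ψ D) ε := by
  have F (x : M) : H.AdaptedFrame x := (H.exists_adaptedFrame x).some
  have hα : ∃ α : DiffOneForm (𝓘(ℝ, E).prod 𝓘(ℝ, ℝ →L[ℝ] ℝ)) H.Cone,
      ∀ (D : H.Der) (ε : H.Cone), α.toFun ε (H.liftDer D ε) = H.lift (ψ D) ε := by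
    refine ⟨⟨fun ε ↦ (F ε.1.1).localOneForm ψ ε, fun X ε₀ ↦ ?_⟩, fun D ε ↦
      (F ε.1.1).eventually_localOneForm.self_of_nhds ψ D⟩
    refine ((F ε₀.1.1).contMDiffAt_localOneForm ψ X).congr_of_eventuallyEq ?_
    filter_upwards [(F ε₀.1.1).eventually_localOneForm] with ε hε
    obtain ⟨D, hD⟩ := exists_liftDer_eq (X ε)
    rw [← hD, hε, (F ε.1.1).eventually_localOneForm.self_of_nhds]
  exact Classical.epsilon_spec (p := fun α : DiffOneForm (𝓘(ℝ, E).prod 𝓘(ℝ, ℝ →L[ℝ] ℝ)) H.Cone ↦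
    ∀ (D : H.Der) (ε : H.Cone), α.toFun ε (H.liftDer D ε) = H.lift (ψ D) ε) hα D ε

theorem liftTwoForm_liftDer (η : H.AtiyahTwoForm) (D D' : H.Der) (ε : H.Cone) :
    (H.liftTwoForm η).toFun ε (H.liftDer D ε) (H.liftDer D' ε) = H.lift (η.toBilin D D') ε := by
  have F (x : M) : H.AdaptedFrame x := (H.exists_adaptedFrame x).some
  have hα : ∃ α : DiffTwoForm (𝓘(ℝ, E).prod 𝓘(ℝ, ℝ →L[ℝ] ℝ)) H.Cone,
      ∀ (D D' : H.Der) (ε : H.Cone),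
        α.toFun ε (H.liftDer D ε) (H.liftDer D' ε) = H.lift (η.toBilin D D') ε := by
    refine ⟨⟨fun ε ↦ (F ε.1.1).localTwoForm η ε, fun ε v ↦ ?_, fun X Y ε₀ ↦ ?_⟩, fun D D' ε ↦
      (F ε.1.1).eventually_localTwoForm.self_of_nhds η D D'⟩
    · obtain ⟨D, rfl⟩ := exists_liftDer_eq v
      rw [(F ε.1.1).eventually_localTwoForm.self_of_nhds, η.alt]
      exact map_zero ε.1.2
    · refine ((F ε₀.1.1).contMDiffAt_localTwoForm η X Y).congr_of_eventuallyEq ?_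
      filter_upwards [(F ε₀.1.1).eventually_localTwoForm] with ε hε
      obtain ⟨D, hD⟩ := exists_liftDer_eq (X ε)
      obtain ⟨D', hD'⟩ := exists_liftDer_eq (Y ε)
      rw [← hD, ← hD', hε, (F ε.1.1).eventually_localTwoForm.self_of_nhds]
  exact Classical.epsilon_spec (p := fun α : DiffTwoForm (𝓘(ℝ, E).prod 𝓘(ℝ, ℝ →L[ℝ] ℝ)) H.Cone ↦
    ∀ (D D' : H.Der) (ε : H.Cone),
      α.toFun ε (H.liftDer D ε) (H.liftDer D' ε) = H.lift (η.toBilin D D') ε) hα D D' ε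

/-- Both covectors send the lift of `D` to the lift of `D.apply l`. This reduces the bracket
identity to the tensor identity. -/
theorem liftOneForm_jet (l : H.NormalSection) (ε : H.Cone) :
    (H.liftOneForm (H.jet l)).toFun ε = (mvfderiv _ (H.lift l) ε).toLinearMap := by
  refine LinearMap.ext fun v ↦ ?_
  obtain ⟨D, rfl⟩ := exists_liftDer_eq v
  exact (liftOneForm_liftDer _ _ _).trans (mvfderiv_lift_liftDer D l ε).symm

theorem IsContact.symplecticForm_flat_symm (hH : H.IsContact) (ψ : H.AtiyahOneForm) (ε : H.Cone) :
    H.symplecticForm.toFun ε (H.liftDer (hH.flat.symm ψ) ε) = (H.liftOneForm ψ).toFun ε := by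
  refine LinearMap.ext fun v ↦ ?_
  obtain ⟨D, rfl⟩ := exists_liftDer_eq v
  rw [liftOneForm_liftDer, symplecticForm, liftTwoForm_liftDer, hH.flat_symm]

/-- The lifts of `flat⁻¹ ψ` and `flat⁻¹ χ` represent the two covectors, so the tensor is the lifted
`ψ` evaluated on the second of them. -/
theorem IsContact.poissonTensor_lift (hH : H.IsContact) (ψ χ : H.AtiyahOneForm) (ε : H.Cone) :
    H.symplecticForm.poissonTensor ε ((H.liftOneForm ψ).toFun ε) ((H.liftOneForm χ).toFun ε) =
      H.lift (ψ (hH.flat.symm χ)) ε := by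
  rw [DiffTwoForm.poissonTensor_eq _ (hH.symplecticForm_flat_symm ψ ε)
    (hH.symplecticForm_flat_symm χ ε), hH.symplecticForm_flat_symm, liftOneForm_liftDer]

end HyperplaneDistribution

end Contact

end ContactGeom

end

theorem proposition5p3 {E : Type*} [NormedAddCommGroup E] [NormedSpace ℝ E]
    [FiniteDimensional ℝ E] {M : Type*} [TopologicalSpace M] [T2Space M]
    [SecondCountableTopology M] [ChartedSpace E M] [IsManifold 𝓘(ℝ, E) ∞ M]
    (H : ContactGeom.HyperplaneDistribution E M) (hH : H.IsContact) :
    (∀ (l m : H.NormalSection) (ε : H.Cone),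
      H.symplecticForm.poissonBracket (H.lift l) (H.lift m) ε = H.lift (H.jacobiBracket l m) ε) ∧
    (∀ (ψ χ : H.AtiyahOneForm) (ε : H.Cone),
      H.symplecticForm.poissonTensor ε ((H.liftOneForm ψ).toFun ε) ((H.liftOneForm χ).toFun ε) =
        H.lift (H.jacobiTensor.toBilin ψ χ) ε) := by
  refine ⟨fun l m ε ↦ ?_, fun ψ χ ε ↦ ?_⟩
  · have h := hH.poissonTensor_lift (H.jet l) (H.jet m) ε
    rw [ContactGeom.HyperplaneDistribution.liftOneForm_jet,
      ContactGeom.HyperplaneDistribution.liftOneForm_jet,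
      ContactGeom.HyperplaneDistribution.jet_apply, ← hH.jacobiBracket_eq] at h
    -- By definition the Poisson bracket is the Poisson tensor evaluated on the differentials of the
    -- two functions.
    exact h
  · rw [hH.poissonTensor_lift, hH.jacobiTensor_apply]
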